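/- **Setting.** Let $T\in\mathbb R^{d\times d}$ be a positive semidefinite (symmetric) Toeplitz matrix of rank $k$ with $2k\le d$, and let $x^{(1)},\dots,x^{(n)}$, $n\ge 1$, be i.i.d. samples from $\mathcal N(0,T)$. For nodes $z_l=e^{-2\pi i f_l}$ let $F_R\in\mathbb C^{m\times k}$ denote the Fourier matrix with entries $(F_R)_{a,l}=z_l^{a}$, $0\le a<m$, where $R=(z_1,\dots,z_k)$; $\|\cdot\|_2$ is the spectral norm. Let $\mathscr O$ be an exact root-finding oracle: given a complex polynomial of degree $k$ whose roots all lie in the closed unit disc, it returns the set of its roots, listed without repetition in some order determined by the polynomial. **Algorithm.** Read the vector $w^{(j)}\in\mathbb R^{2k}$ of the first $2k$ entries of each $x^{(j)}$. For $j=1,\dots,n$: solve $P_k(w^{(j)})c^{(j)}=-b_k(w^{(j)})$, where $P_k(w)_{i,s}=w_{i+s-1}$ and $b_k(w)_i=w_{k+i}$ for $1\le i,s\le k$; find with $\mathscr O$ the $k$ roots $R_j$ of $t^k+\sum_{s=1}^k c^{(j)}_s t^{s-1}$; solve $F_{R_j}\hat y^{(j)}=(w^{(j)}_1,\dots,w^{(j)}_k)^{\top}$,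 with $F_{R_j}\in\mathbb C^{k\times k}$. Output $R=R_1$ and $\hat D=\mathrm{diag}(D_1,\dots,D_k)$, $D_l=\frac1n\sum_{j=1}^n|\hat y^{(j)}_l|^2$. Put $\widehat T=F_R\hat D F_R^*$, with $F_R\in\mathbb C^{d\times k}$. **Theorem.** Almost surely the algorithm has exactly one output, and the nodes in $R$ are $k$ distinct numbers $e^{-2\pi i f}$ with $f\in[0,1)$. There is a universal constant $C>0$ such that for all $\varepsilon\in(0,1)$ $$\Pr\big[\|T-\widehat T\|_2>\varepsilon\|T\|_2\big]\le 2k\exp(-Cn\varepsilon^2).$$ Moreover, there is a single program on a real RAM (unit-cost exact complex arithmetic, independent of $d,k,n,T$ and the oracle) that on almost every sample matrix computes the output $(R,\hat D)$ of the algorithm, and that on every sample matrix reads exactly the first $2k$ entries of each sample, once each ($2kn$ entries in total), makes at most $n$ queries to $\mathscr O$, and runs in $\mathrm{poly}(k,n)$ steps. In particular, there are universal constants $A,B>0$ such that for $k\ge1$ and $\varepsilon,\delta\in(0,1)$: if $n\ge A\log(2k/\delta)/\varepsilon^2$, then $\Pr[\|T-\widehat T\|_2>\varepsilon\|T\|_2]<\delta$;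 and with $n=\lceil A\log(2k/\delta)/\varepsilon^2\rceil$ the program reads $2kn\le B\,k\log(2k/\delta)/\varepsilon^2$ entries in total (independently of $d$), which is also at most $B\,k\log(k/\delta)/\varepsilon^2$ whenever $2\delta\le k$ (that is, always unless $k=1$ and $\delta>1/2$), and runs in $\mathrm{poly}(k,1/\varepsilon,\log(1/\delta))$ steps. -/

import Mathlib

open MeasureTheory ProbabilityTheory Matrix

namespace Prony

noncomputable section

/-! ### Toeplitz matrices, Fourier matrices, spectral norm, samples -/

/-- A real square matrix is (symmetric) Toeplitz if its `(i, j)` entry is `a |i - j|` for some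
sequence `a`. -/
def IsToeplitz {d : ℕ} (T : Matrix (Fin d) (Fin d) ℝ) : Prop :=
  ∃ a : ℕ → ℝ, ∀ i j : Fin d, T i j = a ((i : ℤ) - (j : ℤ)).natAbs

/-- The spectral (Euclidean operator) norm of a complex matrix. -/
def specNorm {d : ℕ} (A : Matrix (Fin d) (Fin d) ℂ) : ℝ :=
  ‖Matrix.toEuclideanCLM (𝕜 := ℂ) A‖

/-- A real matrix regarded as a complex one. -/
def toComplex {d : ℕ} (T : Matrix (Fin d) (Fin d) ℝ) : Matrix (Fin d) (Fin d) ℂ :=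
  T.map (fun t : ℝ => (t : ℂ))

/-- The Fourier matrix `F` with `m` rows whose frequencies `f_l` are given through the nodes
`z_l = exp (-2 π i f_l)`: its `l`-th column is `(1, z_l, z_l ^ 2, …, z_l ^ (m - 1))`. -/
def fourierMatrix (m : ℕ) {s : ℕ} (z : Fin s → ℂ) : Matrix (Fin m) (Fin s) ℂ :=
  Matrix.of fun a l => z l ^ (a : ℕ)

/-- The matrix `F diag(D) F^*` for the Fourier matrix `F` with `d` rows and nodes `z`. -/
def estimate (d : ℕ) {s : ℕ} (z : Fin s → ℂ) (D : Fin s → ℝ) : Matrix (Fin d) (Fin d) ℂ :=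
  fourierMatrix d z * Matrix.diagonal (fun l => (D l : ℂ)) * (fourierMatrix d z)ᴴ

/-- The law of `n` independent samples `x^(1), …, x^(n)` from `N(0, T)`. -/
def samplesLaw {d : ℕ} (T : Matrix (Fin d) (Fin d) ℝ) (n : ℕ) :
    Measure (Fin n → EuclideanSpace ℝ (Fin d)) :=
  Measure.pi fun _ => multivariateGaussian 0 T

/-- The first `2 k` entries of each sample. -/
def firstEntries {d k n : ℕ} (h : 2 * k ≤ d) (x : Fin n → EuclideanSpace ℝ (Fin d)) :
    Fin n → Fin (2 * k) → ℝ :=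
  fun j i => x j (Fin.castLE h i)

/-! ### The root-finding oracle and the algorithm -/

/-- `O` is an exact root-finding oracle in degree `k`: given a polynomial of degree `k` all of whose
roots lie in the closed unit disc, it lists the set of its roots (in an arbitrary order). -/
def IsRootOracle (k : ℕ) (O : Polynomial ℂ → List ℂ) : Prop :=
  ∀ p : Polynomial ℂ, p.degree = (k : WithBot ℕ) → (∀ z, p.IsRoot z → ‖z‖ ≤ 1) →
    (O p).Nodup ∧ ∀ z, z ∈ O p ↔ p.IsRoot z

/-- The `k × k` Hankel matrix `P_k(w)`; with entries of `w` numbered from `1`, its `(i, j)` entry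
is `w_{i + j - 1}`. -/
def hankel {k : ℕ} (w : Fin (2 * k) → ℝ) : Matrix (Fin k) (Fin k) ℂ :=
  Matrix.of fun i j => ((w ⟨(i : ℕ) + (j : ℕ), by omega⟩ : ℝ) : ℂ)

/-- The vector `b_k(w)`; with entries of `w` numbered from `1`, its `i`-th entry is `w_{k + i}`. -/
def shifted {k : ℕ} (w : Fin (2 * k) → ℝ) : Fin k → ℂ :=
  fun i => ((w ⟨k + (i : ℕ), by omega⟩ : ℝ) : ℂ)

/-- The first `k` entries of `w`. -/
def firstHalf {k : ℕ} (w : Fin (2 * k) → ℝ) : Fin k → ℂ :=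
  fun i => ((w ⟨(i : ℕ), by omega⟩ : ℝ) : ℂ)

/-- The monic polynomial `t ^ k + ∑_{s = 1}^k c_s t ^ (s - 1)`. -/
def pronyPoly {k : ℕ} (c : Fin k → ℂ) : Polynomial ℂ :=
  Polynomial.X ^ k + ∑ s : Fin k, Polynomial.C (c s) * Polynomial.X ^ (s : ℕ)

/-- Prony's method on one column `w`: `c` solves `P_k(w) c = -b_k(w)`, the oracle applied to the
polynomial with coefficients `c` returns the `k` roots `r`, and `y` solves `F_r y = w_{[k]}`. -/
structure IsPronyStep {k : ℕ} (O : Polynomial ℂ → List ℂ) (w : Fin (2 * k) → ℝ)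
    (c r y : Fin k → ℂ) : Prop where
  coeffs : hankel w *ᵥ c = -shifted w
  roots : O (pronyPoly c) = List.ofFn r
  weights : fourierMatrix k r *ᵥ y = firstHalf w

/-- `(R, D)` is an output of the covariance estimation algorithm based on Prony's method on the
columns `W j`: Prony's method is applied to every column, giving roots `r j` and weights `y j`;
then `R` is the list of roots found for the first column, and
`D_l = (1 / n) ∑_j |y^(j)_l|^2`. -/
def IsOutput {k n : ℕ} (O : Polynomial ℂ → List ℂ) (W : Fin n → Fin (2 * k) → ℝ)
    (R : Fin k → ℂ) (D : Fin k → ℝ) : Prop :=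
  ∃ c r y : Fin n → Fin k → ℂ,
    (∀ j, IsPronyStep O (W j) (c j) (r j) (y j)) ∧
    (∀ j : Fin n, (j : ℕ) = 0 → R = r j) ∧
    ∀ l, D l = (1 / (n : ℝ)) * ∑ j, ‖y j l‖ ^ 2

/-! ### A real-RAM with entry queries and a root-finding oracle

Programs act on index registers (natural numbers) and on two-dimensional arrays of complex numbers.
Every instruction costs one step, and so does every test and every iteration of a loop. Reads of
sample entries and oracle queries are recorded separately as well. Natural numbers can only be
added and subtracted, so that after `t` steps they have `O(t)` bits. Complex numbers can be added,
subtracted, multiplied, divided, conjugated and compared with zero. -/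

/-- `⟨A, i, j⟩` refers to the cell of array `A` whose row and column are the current contents of the
index registers `i` and `j`. -/
structure Loc where
  arr : ℕ
  row : ℕ
  col : ℕ

inductive Cmd where
  /-- index register `x := m` -/
  | idxConst (x m : ℕ)
  /-- `x := y + z` for index registers -/
  | idxAdd (x y z : ℕ)
  /-- `x := y - z` (truncated) for index registers -/
  | idxSub (x y z : ℕ)
  /-- cell `u := m` -/
  | const (u : Loc) (m : ℤ)
  | add (u v w : Loc)
  | sub (u v w : Loc)
  | mul (u v w : Loc)
  /-- `u := v / w`, where division by zero gives zero -/
  | div (u v w : Loc)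
  | conj (u v : Loc)
  /-- `u :=` the entry of a sample; the index registers `i` and `j` hold the number of the entry
  and the number of the sample -/
  | read (u : Loc) (i j : ℕ)
  /-- calls the oracle on the polynomial whose degree bound is in index register `m` and whose
  coefficients are in row `0` of array `A`, and writes the list it returns to row `0` of array `B`,
  padded with zeros -/
  | query (A B m : ℕ)
  | seq (p q : Cmd)
  /-- `if u = 0 then p else q` -/
  | ifZero (u : Loc) (p q : Cmd)
  /-- `if x < y then p else q` for index registers -/
  | ifLt (x y : ℕ) (p q : Cmd)
  /-- `for x = 0, …, N - 1 do p`, where `N` is the content of index register `b` on entry -/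
  | loop (x b : ℕ) (p : Cmd)

/-- A configuration: contents of the index registers and of the arrays, number of steps and of
oracle queries so far, and the list of the pairs (entry, sample) read so far. -/
structure Config where
  idx : ℕ → ℕ
  mem : ℕ → ℕ → ℕ → ℂ
  steps : ℕ
  queries : ℕ
  reads : List (ℕ × ℕ)

namespace Config

def tick (s : Config) : Config := { s with steps := s.steps + 1 }

def get (s : Config) (u : Loc) : ℂ := s.mem u.arr (s.idx u.row) (s.idx u.col)

def setIdx (s : Config) (x v : ℕ) : Config := { s with idx := Function.update s.idx x v }

def set (s : Config) (u : Loc) (v : ℂ) : Config :=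
  { s with mem := fun A i j =>
      if A = u.arr ∧ i = s.idx u.row ∧ j = s.idx u.col then v else s.mem A i j }

def polyAt (s : Config) (A m : ℕ) : Polynomial ℂ :=
  ∑ i ∈ Finset.range (s.idx m + 1), Polynomial.C (s.mem A 0 i) * Polynomial.X ^ i

def setRow (s : Config) (B : ℕ) (L : List ℂ) : Config :=
  { s with mem := fun A i j => if A = B ∧ i = 0 then L.getD j 0 else s.mem A i j }

end Config

open Classical in
/-- Execution of a program with oracle `O` on samples whose `i`-th entry in the `j`-th sample is
`X i j`. -/
def exec (O : Polynomial ℂ → List ℂ) (X : ℕ → ℕ → ℝ) : Cmd → Config → Config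
  | .idxConst x m, s => s.tick.setIdx x m
  | .idxAdd x y z, s => s.tick.setIdx x (s.idx y + s.idx z)
  | .idxSub x y z, s => s.tick.setIdx x (s.idx y - s.idx z)
  | .const u m, s => s.tick.set u (m : ℂ)
  | .add u v w, s => s.tick.set u (s.get v + s.get w)
  | .sub u v w, s => s.tick.set u (s.get v - s.get w)
  | .mul u v w, s => s.tick.set u (s.get v * s.get w)
  | .div u v w, s => s.tick.set u (s.get v / s.get w)
  | .conj u v, s => s.tick.set u (starRingEnd ℂ (s.get v))
  | .read u i j, s =>
      { s.tick.set u ((X (s.idx i) (s.idx j) : ℝ) : ℂ) with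
        reads := (s.idx i, s.idx j) :: s.reads }
  | .query A B m, s =>
      { s.tick.setRow B (O (s.polyAt A m)) with queries := s.queries + 1 }
  | .seq p q, s => exec O X q (exec O X p s)
  | .ifZero u p q, s => if s.get u = 0 then exec O X p s.tick else exec O X q s.tick
  | .ifLt x y p q, s => if s.idx x < s.idx y then exec O X p s.tick else exec O X q s.tick
  | .loop x b p, s =>
      (List.range (s.idx b)).foldl (fun t i => exec O X p (t.tick.setIdx x i)) s.tick

/-- The entries of the samples, as queried by a program (entries that do not exist read as `0`). -/
def entry {d n : ℕ} (x : Fin n → EuclideanSpace ℝ (Fin d)) (i j : ℕ) : ℝ :=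
  if h : i < d ∧ j < n then x ⟨j, h.2⟩ ⟨i, h.1⟩ else 0

/-- The initial configuration: index registers `0` and `1` hold `k` and `n`, all else is zero. -/
def init (k n : ℕ) : Config where
  idx := fun x => if x = 0 then k else if x = 1 then n else 0
  mem := fun _ _ _ => 0
  steps := 0
  queries := 0
  reads := []

/-- The final configuration of the program `P` with parameters `k` and `n` on the samples `x`. -/
def run (P : Cmd) (O : Polynomial ℂ → List ℂ) (k : ℕ) {d n : ℕ}
    (x : Fin n → EuclideanSpace ℝ (Fin d)) : Config :=
  exec O (entry x) P (init k n)

/-- The configuration `s` holds `R` and `D` in the first `k` cells of row `0` of arrays `0`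
and `1`. -/
def Config.Holds {k : ℕ} (s : Config) (R : Fin k → ℂ) (D : Fin k → ℝ) : Prop :=
  ∀ l : Fin k, s.mem 0 0 l = R l ∧ s.mem 1 0 l = (D l : ℂ)

/-- The event that an output of the algorithm has error more than `ε ‖T‖₂`. -/
def failure {d k : ℕ} (h : 2 * k ≤ d) (T : Matrix (Fin d) (Fin d) ℝ)
    (O : Polynomial ℂ → List ℂ) (n : ℕ) (ε : ℝ) : Set (Fin n → EuclideanSpace ℝ (Fin d)) :=
  {x | ∃ (R : Fin k → ℂ) (D : Fin k → ℝ), IsOutput O (firstEntries h x) R D ∧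
    ε * specNorm (toComplex T) < specNorm (toComplex T - estimate d R D)}

end

end Prony

/-! Write `T` as a Gram matrix of vectors `v_0, …, v_{d-1}`. The Toeplitz property says that the
shift `v_i ↦ v_{i+1}` preserves inner products, so it extends to a linear isometry `U` with `v_i =
U^i v_0`. Splitting `v_0` into eigenvectors of `U` gives Carathéodory's decomposition `T = F diag(D)
F^*` with distinct unimodular nodes and positive weights (`exists_vandermonde_decomposition`). By
`rank_estimate` there are exactly `k` nodes.

A Gaussian sample almost surely lies in the column space of `F`, say `x = F y`. Each `y_l` is a
complex linear functional of `x` with second absolute moment `D_l > 0`, hence almost surely nonzero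
(`exists_weights`). Then the Hankel matrix is `V diag(y) V^T` with `V` square Vandermonde, and the
residual `P_k c + b_k` equals `V` applied to `y_l p_c(z_l)`. So Prony's system has a unique
solution, the coefficients of `∏ (t - z_l)`, whatever the sample (`IsGeneric.coeffs_iff`). The nodes
are thus recovered exactly, the oracle returns the same list for all samples, and only the weights
carry error (`isOutput_iff_of_isGeneric`).

If every weight has relative error at most `ε`, then `T - T̂ = B Δ B^*` with `T = B B^*` and `‖Δ‖ ≤
ε`, so `‖T - T̂‖ ≤ ε ‖T‖` regardless of the separation of the nodes (`specNorm_estimate_le`).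
Chernoff's bound for the empirical mean of `|y_l|^2` (`measure_empirical_moment_le`) and a union
bound over `l` and the two signs give the tail. Independence is used only between samples, not
between the coordinates of `y`.

The program takes the nodes from the first sample alone, with one query, and solves linear systems
by successive orthogonal projection, which needs no pivoting (`IsPartialSolution.succ`). It has no
data-dependent branch, and its loops are bounded by the never-written registers holding `k` and `n`.
Its resource bounds therefore hold on every input, while `holds_run_program` needs generic samples.
-/

namespace Prony

/-! ### Carathéodory decomposition and its stability in the weights. -/

section Caratheodory

/-- A linear isometry of a finite-dimensional inner product space is diagonalizable. -/
lemma iSup_eigenspace_isometry {V : Type*} [NormedAddCommGroup V] [InnerProductSpace ℂ V]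
    [FiniteDimensional ℂ V] (U : V →ₗᵢ[ℂ] V) :
    ⨆ z : ℂ, Module.End.eigenspace (U.toLinearMap : Module.End ℂ V) z = ⊤ := by
  apply Module.End.IsSemisimple.iSup_eigenspace_eq_top
  rw [Module.End.isSemisimple_iff]
  intro p hp
  have hp' : p ≤ p.comap U.toLinearMap := by simpa [Module.End.mem_invtSubmodule] using hp
  refine ⟨pᗮ, ?_, Submodule.isCompl_orthogonal _⟩
  rw [Module.End.mem_invtSubmodule]
  intro x hx
  rw [Submodule.mem_comap, Submodule.mem_orthogonal]
  intro u hu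
  -- In finite dimension an injective map of `p` into itself is onto, so each `u ∈ p` is some `U u'`
  -- with `u' ∈ p`, and `⟨u, U x⟩ = ⟨u', x⟩ = 0`.
  have hmap : p.map U.toLinearMap = p := by
    apply Submodule.eq_of_le_of_finrank_eq
    · exact Submodule.map_le_iff_le_comap.mpr hp'
    · exact (Submodule.equivMapOfInjective U.toLinearMap U.injective p).finrank_eq.symm
  rw [← hmap] at hu
  obtain ⟨u', hu', rfl⟩ := hu
  have := U.inner_map_map u' x
  simp only [LinearIsometry.coe_toLinearMap] at *
  rw [this]
  exact (Submodule.mem_orthogonal _ _).1 hx u' hu'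

/-- The Gram matrix of the orbit of a vector under a linear isometry is a positive combination of
rank one Fourier matrices. -/
lemma exists_orbit_inner_eq {V : Type*} [NormedAddCommGroup V] [InnerProductSpace ℂ V]
    [FiniteDimensional ℂ V] (U : V →ₗᵢ[ℂ] V) (v : V) :
    ∃ (Z : Finset ℂ) (D : ℂ → ℝ), (∀ z ∈ Z, ‖z‖ = 1) ∧ (∀ z ∈ Z, 0 < D z) ∧
      Z.card ≤ Module.finrank ℂ V ∧
      ∀ i j : ℕ, inner ℂ ((U^[j]) v) ((U^[i]) v) =
        ∑ z ∈ Z, (D z : ℂ) * (z ^ i * (starRingEnd ℂ) (z ^ j)) := by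
  classical
  have hv : v ∈ ⨆ z : ℂ, Module.End.eigenspace (U.toLinearMap : Module.End ℂ V) z := by
    rw [iSup_eigenspace_isometry]; trivial
  obtain ⟨f, hf, hsum⟩ := (Submodule.mem_iSup_iff_exists_finsupp _ _).1 hv
  have hU : ∀ z, U (f z) = z • f z := fun z => Module.End.mem_eigenspace_iff.1 (hf z)
  have hne : ∀ z ∈ f.support, f z ≠ 0 := fun z hz => Finsupp.mem_support_iff.1 hz
  have hnorm : ∀ z ∈ f.support, ‖z‖ = 1 := by
    intro z hz
    have h1 : ‖U (f z)‖ = ‖f z‖ := U.norm_map _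
    rw [hU, norm_smul] at h1
    have h2 : ‖f z‖ ≠ 0 := norm_ne_zero_iff.2 (hne z hz)
    field_simp at h1
    exact h1
  have horth : ∀ z ∈ f.support, ∀ w ∈ f.support, z ≠ w → inner ℂ (f z) (f w) = 0 := by
    intro z hz w _ hzw
    by_contra h
    have h1 := U.inner_map_map (f z) (f w)
    rw [hU, hU, inner_smul_left, inner_smul_right, ← mul_assoc] at h1
    have h2 : (starRingEnd ℂ) z * w = 1 := mul_right_cancel₀ h (by rw [h1, one_mul])
    have h3 : z * (starRingEnd ℂ) z = 1 := by
      rw [Complex.mul_conj, Complex.normSq_eq_norm_sq, hnorm z hz]; simp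
    apply hzw
    calc z = z * ((starRingEnd ℂ) z * w) := by rw [h2, mul_one]
      _ = w := by rw [← mul_assoc, h3, one_mul]
  have hpow : ∀ i : ℕ, (U^[i]) v = ∑ z ∈ f.support, z ^ i • f z := by
    intro i
    induction i with
    | zero => simpa [Finsupp.sum] using hsum.symm
    | succ i ih =>
      rw [Function.iterate_succ_apply', ih, map_sum]
      refine Finset.sum_congr rfl fun z _ => ?_
      rw [map_smul, hU, smul_smul, pow_succ]
  -- The nodes are the eigenvalues that occur in `v`, the weights the squared norms of its
  -- eigencomponents. Restricting to the support makes the weights positive.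
  refine ⟨f.support, fun z => ‖f z‖ ^ 2, hnorm, ?_, ?_, ?_⟩
  · intro z hz
    have := norm_pos_iff.2 (hne z hz)
    positivity
  · have hli := Module.End.eigenvectors_linearIndependent' (U.toLinearMap : Module.End ℂ V)
      (fun z : f.support => (z : ℂ)) Subtype.coe_injective (fun z => f z)
      (fun z => ⟨hf z, hne z z.2⟩)
    simpa using hli.fintype_card_le_finrank
  · intro i j
    rw [hpow, hpow, sum_inner]
    refine Finset.sum_congr rfl fun z hz => ?_
    rw [inner_sum, Finset.sum_eq_single z]
    · rw [inner_smul_left, inner_smul_right, inner_self_eq_norm_sq_to_K]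
      push_cast
      simp only [Complex.coe_algebraMap]
      ring
    · intro w hw hwz
      rw [inner_smul_left, inner_smul_right, horth z hz w hw hwz.symm]; simp
    · exact fun h => absurd hz h

/-- Two linear maps with the same pulled back norm differ by a linear isometry. -/
lemma exists_isometry_comp {E V : Type*} [AddCommGroup E] [Module ℂ E] [NormedAddCommGroup V]
    [InnerProductSpace ℂ V] [FiniteDimensional ℂ V] (W₁ W₂ : E →ₗ[ℂ] V)
    (h : ∀ x, ‖W₁ x‖ = ‖W₂ x‖) : ∃ U : V →ₗᵢ[ℂ] V, ∀ x, U (W₁ x) = W₂ x := by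
  have hker : LinearMap.ker W₁ ≤ LinearMap.ker W₂ := by
    intro x hx
    rw [LinearMap.mem_ker] at *
    rw [← norm_eq_zero, ← h, hx, norm_zero]
  let g : LinearMap.range W₁ →ₗ[ℂ] V :=
    (Submodule.liftQ _ W₂ hker) ∘ₗ W₁.quotKerEquivRange.symm.toLinearMap
  have hg : ∀ x, g ⟨W₁ x, LinearMap.mem_range_self W₁ x⟩ = W₂ x := by
    intro x
    have : W₁.quotKerEquivRange.symm ⟨W₁ x, LinearMap.mem_range_self W₁ x⟩ =
        (Submodule.Quotient.mk x) := by
      rw [LinearEquiv.symm_apply_eq]; rfl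
    simp only [g, LinearMap.comp_apply, LinearEquiv.coe_coe, this, Submodule.liftQ_apply]
  let L : LinearMap.range W₁ →ₗᵢ[ℂ] V :=
    ⟨g, by
      rintro ⟨_, x, rfl⟩
      rw [hg, ← h]; rfl⟩
  -- An isometry defined on a subspace extends to the whole space, since the orthogonal complements
  -- of domain and image have equal dimension.
  refine ⟨L.extend, fun x => ?_⟩
  have := L.extend_apply ⟨W₁ x, LinearMap.mem_range_self W₁ x⟩
  rw [← hg x]
  exact this

/-- A positive semidefinite Toeplitz matrix has a Vandermonde decomposition. -/
lemma exists_vandermonde_decomposition {d : ℕ} (T : Matrix (Fin d) (Fin d) ℝ) (hT : T.PosSemidef)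
    (hTo : IsToeplitz T) :
    ∃ (s : ℕ) (z : Fin s → ℂ) (D : Fin s → ℝ), s ≤ d ∧ Function.Injective z ∧
      (∀ l, ‖z l‖ = 1) ∧ (∀ l, 0 < D l) ∧ toComplex T = estimate d z D := by
  classical
  rcases d with _ | m
  · exact ⟨0, fun i => i.elim0, fun i => i.elim0, le_rfl, fun i => i.elim0, fun i => i.elim0,
      fun i => i.elim0, by ext i; exact i.elim0⟩
  obtain ⟨a, ha⟩ := hTo
  open scoped MatrixOrder in
  obtain ⟨B, hB⟩ := CStarAlgebra.nonneg_iff_eq_star_mul_self.mp hT.nonneg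
  let v : Fin (m + 1) → EuclideanSpace ℂ (Fin (m + 1)) := fun i =>
    WithLp.toLp 2 fun b => ((B b i : ℝ) : ℂ)
  have hv : ∀ i j, inner ℂ (v j) (v i) = ((a ((i : ℤ) - (j : ℤ)).natAbs : ℝ) : ℂ) := by
    intro i j
    rw [← ha, hB]
    simp [v, PiLp.inner_apply, Matrix.mul_apply, Matrix.star_eq_conjTranspose]
  -- The two families omit the last and the first Gram vector respectively. They have the same Gram
  -- matrix because its entries depend only on `i - j`.
  let W₁ : (Fin m → ℂ) →ₗ[ℂ] EuclideanSpace ℂ (Fin (m + 1)) :=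
    Fintype.linearCombination ℂ fun i : Fin m => v i.castSucc
  let W₂ : (Fin m → ℂ) →ₗ[ℂ] EuclideanSpace ℂ (Fin (m + 1)) :=
    Fintype.linearCombination ℂ fun i : Fin m => v i.succ
  obtain ⟨U, hU⟩ := exists_isometry_comp W₁ W₂ (by
    intro x
    have : inner ℂ (W₁ x) (W₁ x) = inner ℂ (W₂ x) (W₂ x) := by
      simp only [W₁, W₂, Fintype.linearCombination_apply, sum_inner, inner_sum, inner_smul_left,
        inner_smul_right, hv]
      simp
    rw [inner_self_eq_norm_sq_to_K, inner_self_eq_norm_sq_to_K] at this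
    have h2 : ‖W₁ x‖ ^ 2 = ‖W₂ x‖ ^ 2 := by exact_mod_cast this
    exact (pow_left_inj₀ (norm_nonneg _) (norm_nonneg _) two_ne_zero).1 h2)
  have hstep : ∀ i : Fin m, U (v i.castSucc) = v i.succ := by
    intro i
    have := hU (Pi.single i 1)
    simpa [W₁, W₂, Fintype.linearCombination_apply_single] using this
  have horb : ∀ (i : ℕ) (hi : i < m + 1), v ⟨i, hi⟩ = (U^[i]) (v 0) := by
    intro i
    induction i with
    | zero => intro _; rfl
    | succ i ih =>
      intro hi
      rw [Function.iterate_succ_apply', ← ih (by omega)]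
      exact (hstep ⟨i, by omega⟩).symm
  obtain ⟨Z, D, hZ, hD, hcard, hin⟩ := exists_orbit_inner_eq U (v 0)
  let e := Z.equivFin
  refine ⟨Z.card, fun l => (e.symm l : ℂ), fun l => D (e.symm l), by simpa using hcard, ?_,
    fun l => hZ _ (e.symm l).2, fun l => hD _ (e.symm l).2, ?_⟩
  · exact Subtype.coe_injective.comp e.symm.injective
  · ext i j
    have h1 : toComplex T i j = inner ℂ (v j) (v i) := by rw [hv, ← ha]; rfl
    rw [h1, horb i i.2, horb j j.2, hin, ← Finset.sum_coe_sort Z, ← e.symm.sum_comp]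
    rw [estimate, Matrix.mul_apply]
    refine Finset.sum_congr rfl fun l _ => ?_
    simp [fourierMatrix, Matrix.mul_diagonal]
    ring

/-- The rank of a real matrix does not change when it is regarded as a complex one. -/
lemma rank_toComplex {d : ℕ} (T : Matrix (Fin d) (Fin d) ℝ) : (toComplex T).rank = T.rank := by
  classical
  -- A factorization into transvections and a diagonal survives the change of field, and either rank
  -- counts the nonzero `w i`.
  obtain ⟨L, L', w, h⟩ := Matrix.Pivot.exists_list_transvec_mul_diagonal_mul_list_transvec T
  set P := (L.map Matrix.TransvectionStruct.toMatrix).prod with hP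
  set Q := (L'.map Matrix.TransvectionStruct.toMatrix).prod with hQ
  have hPd : P.det = 1 := Matrix.TransvectionStruct.det_toMatrix_prod L
  have hQd : Q.det = 1 := Matrix.TransvectionStruct.det_toMatrix_prod L'
  have hmap : toComplex T = P.map Complex.ofRealHom *
      Matrix.diagonal (fun i => ((w i : ℝ) : ℂ)) * Q.map Complex.ofRealHom := by
    have h1 : toComplex T = T.map Complex.ofRealHom := rfl
    rw [h1, h, Matrix.map_mul, Matrix.map_mul, Matrix.diagonal_map (map_zero _)]
    rfl
  have hdet : ∀ M : Matrix (Fin d) (Fin d) ℝ, M.det = 1 → (M.map Complex.ofRealHom).det ≠ 0 := by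
    intro M hM
    rw [← RingHom.mapMatrix_apply, ← RingHom.map_det, hM]
    simp
  rw [hmap, Matrix.rank_mul_eq_left_of_det_ne_zero _ _ (hdet Q hQd),
    Matrix.rank_mul_eq_right_of_det_ne_zero _ _ (hdet P hPd), Matrix.rank_diagonal, h,
    Matrix.rank_mul_eq_left_of_det_ne_zero _ _ (by simp [hQd]),
    Matrix.rank_mul_eq_right_of_det_ne_zero _ _ (by simp [hPd]), Matrix.rank_diagonal]
  simp

lemma fourierMatrix_mulVec_injective {m s : ℕ} (h : s ≤ m) {z : Fin s → ℂ}
    (hz : Function.Injective z) {y : Fin s → ℂ}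
    (hy : ∀ a : Fin s, (fourierMatrix m z *ᵥ y) (Fin.castLE h a) = 0) : y = 0 := by
  refine Matrix.eq_zero_of_forall_pow_sum_mul_pow_eq_zero hz fun a => ?_
  have := hy a
  simpa [Matrix.mulVec, dotProduct, fourierMatrix, mul_comm] using this

/-- Splitting the weights into square roots gives the form `B B^*`, from which both the rank and the
norm are read off. -/
lemma estimate_eq_mul_conjTranspose {d s : ℕ} (z : Fin s → ℂ) {D : Fin s → ℝ}
    (hD : ∀ l, 0 ≤ D l) :
    estimate d z D = (fourierMatrix d z * Matrix.diagonal fun l => ((√(D l) : ℝ) : ℂ)) *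
      (fourierMatrix d z * Matrix.diagonal fun l => ((√(D l) : ℝ) : ℂ))ᴴ := by
  rw [Matrix.conjTranspose_mul, Matrix.diagonal_conjTranspose, ← Matrix.mul_assoc,
    Matrix.mul_assoc (fourierMatrix d z), Matrix.diagonal_mul_diagonal, estimate]
  congr 3
  ext l
  simp [← Complex.ofReal_mul, Real.mul_self_sqrt (hD l)]

/-- `B B^*` has the rank of `B`, and distinct nodes give independent columns as long as there are at
least `s` rows. This identifies the number of nodes with the rank of `T`. -/
lemma rank_estimate {d s : ℕ} (h : s ≤ d) {z : Fin s → ℂ} (hz : Function.Injective z)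
    {D : Fin s → ℝ} (hD : ∀ l, 0 < D l) : (estimate d z D).rank = s := by
  open scoped ComplexOrder in
  rw [estimate_eq_mul_conjTranspose z fun l => (hD l).le, Matrix.rank_self_mul_conjTranspose,
    Matrix.rank_mul_eq_left_of_det_ne_zero]
  · have hli : LinearIndependent ℂ (fourierMatrix d z).col := by
      rw [← Matrix.mulVec_injective_iff]
      intro y y' hyy
      rw [← sub_eq_zero]
      apply fourierMatrix_mulVec_injective h hz
      intro a
      rw [Matrix.mulVec_sub, Pi.sub_apply, hyy, sub_self]
    rw [← Matrix.rank_transpose]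
    simpa using LinearIndependent.rank_matrix (M := (fourierMatrix d z)ᵀ) hli
  · rw [Matrix.det_diagonal, Finset.prod_ne_zero_iff]
    intro l _
    have := hD l
    simp [Real.sqrt_eq_zero', this]

lemma exists_fourier_decomposition {d : ℕ} (T : Matrix (Fin d) (Fin d) ℝ) (hT : T.PosSemidef)
    (hTo : IsToeplitz T) :
    ∃ (z : Fin T.rank → ℂ) (D : Fin T.rank → ℝ), Function.Injective z ∧
      (∀ l, ‖z l‖ = 1) ∧ (∀ l, 0 < D l) ∧ toComplex T = estimate d z D := by
  obtain ⟨s, z, D, hs, hz, hz1, hD, h⟩ := exists_vandermonde_decomposition T hT hTo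
  have : T.rank = s := by rw [← rank_toComplex, h, rank_estimate hs hz hD]
  rw [this]
  exact ⟨z, D, hz, hz1, hD, h⟩

/-- The difference is `B Δ B^*` with `Δ` the diagonal matrix of relative errors, and `‖B‖ ^ 2 = ‖B
B^*‖`. The conditioning of the Fourier matrix never enters. -/
lemma specNorm_estimate_le {d s : ℕ} (z : Fin s → ℂ) {D E : Fin s → ℝ} {ε : ℝ} (hε : 0 ≤ ε)
    (hD : ∀ l, 0 < D l) (hE : ∀ l, |D l - E l| ≤ ε * D l) :
    specNorm (estimate d z D - estimate d z E) ≤ ε * specNorm (estimate d z D) := by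
  open scoped Matrix.Norms.L2Operator in
  have hnorm : ∀ A : Matrix (Fin d) (Fin d) ℂ, specNorm A = ‖A‖ := fun A =>
    (Matrix.cstar_norm_def A).symm
  rw [hnorm, hnorm]
  set B := fourierMatrix d z * Matrix.diagonal fun l => ((√(D l) : ℝ) : ℂ) with hB
  have h1 : estimate d z D = B * Bᴴ := estimate_eq_mul_conjTranspose z fun l => (hD l).le
  have h2 : estimate d z D - estimate d z E =
      B * Matrix.diagonal (fun l => (((D l - E l) / D l : ℝ) : ℂ)) * Bᴴ := by
    rw [hB, Matrix.conjTranspose_mul, Matrix.diagonal_conjTranspose, ← Matrix.mul_assoc,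
      Matrix.mul_assoc (fourierMatrix d z), Matrix.diagonal_mul_diagonal,
      Matrix.mul_assoc (fourierMatrix d z), Matrix.diagonal_mul_diagonal, estimate, estimate,
      ← Matrix.sub_mul, ← Matrix.mul_sub, Matrix.diagonal_sub]
    congr 3
    ext l
    have h3 : √(D l) * ((D l - E l) / D l) * √(D l) = D l - E l := by
      have := hD l
      rw [mul_right_comm, Real.mul_self_sqrt this.le]
      field_simp
    simp only [Pi.star_apply, RCLike.star_def, Complex.conj_ofReal]
    exact_mod_cast h3.symm
  have h4 : ‖B * Bᴴ‖ = ‖B‖ * ‖B‖ := by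
    have := Matrix.l2_opNorm_conjTranspose_mul_self Bᴴ
    rwa [Matrix.conjTranspose_conjTranspose, Matrix.l2_opNorm_conjTranspose] at this
  have h5 : ‖(Matrix.diagonal (fun l => (((D l - E l) / D l : ℝ) : ℂ)) :
      Matrix (Fin s) (Fin s) ℂ)‖ ≤ ε := by
    rw [Matrix.l2_opNorm_diagonal, pi_norm_le_iff_of_nonneg hε]
    intro l
    rw [Complex.norm_real, Real.norm_eq_abs, abs_div, abs_of_pos (hD l), div_le_iff₀ (hD l)]
    exact hE l
  rw [h2, h1, h4]
  calc ‖B * Matrix.diagonal (fun l => (((D l - E l) / D l : ℝ) : ℂ)) * Bᴴ‖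
      ≤ ‖B * Matrix.diagonal (fun l => (((D l - E l) / D l : ℝ) : ℂ))‖ * ‖Bᴴ‖ :=
        Matrix.l2_opNorm_mul _ _
    _ ≤ (‖B‖ * ε) * ‖B‖ := by
        rw [Matrix.l2_opNorm_conjTranspose]
        gcongr
        exact (Matrix.l2_opNorm_mul _ _).trans (by gcongr)
    _ = ε * (‖B‖ * ‖B‖) := by ring

end Caratheodory

/-! ### Prony's method on exact moments. -/

section PronyMethod

variable {k : ℕ}

lemma estimate_comp_equiv (d : ℕ) (z : Fin k → ℂ) (D : Fin k → ℝ) (σ : Equiv.Perm (Fin k)) :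
    estimate d (z ∘ σ) (D ∘ σ) = estimate d z D := by
  ext i j
  rw [estimate, estimate, Matrix.mul_apply, Matrix.mul_apply]
  simp only [Matrix.mul_diagonal]
  exact Equiv.sum_comp σ fun l => fourierMatrix d z i l * (D l : ℂ) * (fourierMatrix d z)ᴴ l j

/-- A duplicate-free list with the same members as `z` is a permutation of `z`. This allows the
nodes to be relabelled in the order chosen by the oracle. -/
lemma exists_oracle_order {O : Polynomial ℂ → List ℂ} (hO : IsRootOracle k O) {z : Fin k → ℂ}
    (hz : Function.Injective z) (hz1 : ∀ l, ‖z l‖ = 1) :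
    ∃ σ : Equiv.Perm (Fin k),
      O (∏ l, (Polynomial.X - Polynomial.C (z l))) = List.ofFn (z ∘ σ) := by
  classical
  set p : Polynomial ℂ := ∏ l, (Polynomial.X - Polynomial.C (z l)) with hp
  have hroot : ∀ x, p.IsRoot x ↔ ∃ l, z l = x := by
    intro x
    rw [hp, Polynomial.IsRoot.def, Polynomial.eval_prod, Finset.prod_eq_zero_iff]
    simp [sub_eq_zero, eq_comm]
  obtain ⟨hnd, hmem⟩ := hO p
    (by rw [hp, Polynomial.degree_prod]; simp)
    (fun x hx => by obtain ⟨l, rfl⟩ := (hroot x).1 hx; exact (hz1 l).le)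
  have hlen : (O p).length = k := by
    rw [← List.toFinset_card_of_nodup hnd]
    have : (O p).toFinset = Finset.univ.image z := by
      ext x
      rw [List.mem_toFinset, hmem, hroot]
      simp
    rw [this, Finset.card_image_of_injective _ hz, Finset.card_univ, Fintype.card_fin]
  have hex : ∀ i : Fin k, ∃ l, z l = (O p).get (i.cast hlen.symm) := fun i =>
    (hroot _).1 ((hmem _).1 (List.get_mem _ _))
  choose σ hσ using hex
  have hinj : Function.Injective σ := by
    intro i j hij
    have h1 : (O p).get (i.cast hlen.symm) = (O p).get (j.cast hlen.symm) := by
      rw [← hσ, ← hσ, hij]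
    have h2 := hnd.injective_get h1
    exact Fin.ext (by simpa using congrArg Fin.val h2)
  refine ⟨Equiv.ofBijective σ (Finite.injective_iff_bijective.1 hinj), ?_⟩
  apply List.ext_get
  · simp [hlen]
  · intro i h1 h2
    simpa using (hσ ⟨i, by simpa using h2⟩).symm

lemma pronyPoly_eval (c : Fin k → ℂ) (x : ℂ) :
    (pronyPoly c).eval x = x ^ k + ∑ s : Fin k, c s * x ^ (s : ℕ) := by
  simp [pronyPoly, Polynomial.eval_finsetSum]

lemma degree_pronyPoly_tail (c : Fin k → ℂ) :
    (∑ s : Fin k, Polynomial.C (c s) * Polynomial.X ^ (s : ℕ)).degree < (k : WithBot ℕ) := by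
  refine lt_of_le_of_lt (Polynomial.degree_sum_le _ _) ?_
  refine (Finset.sup_lt_iff (WithBot.bot_lt_coe k)).2 fun s _ => ?_
  exact lt_of_le_of_lt (Polynomial.degree_C_mul_X_pow_le _ _) (WithBot.coe_lt_coe.2 s.2)

lemma pronyPoly_monic (c : Fin k → ℂ) : (pronyPoly c).Monic :=
  Polynomial.monic_X_pow_add (degree_pronyPoly_tail c)

lemma pronyPoly_degree (c : Fin k → ℂ) : (pronyPoly c).degree = (k : WithBot ℕ) := by
  rw [pronyPoly, Polynomial.degree_add_eq_left_of_degree_lt, Polynomial.degree_X_pow]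
  rw [Polynomial.degree_X_pow]
  exact degree_pronyPoly_tail c

/-- Both sides are monic of degree `k`, so their difference has degree below `k` and is determined
by its values at `k` distinct points. -/
lemma pronyPoly_eq_prod_iff {z : Fin k → ℂ} (hz : Function.Injective z) (c : Fin k → ℂ) :
    pronyPoly c = ∏ l, (Polynomial.X - Polynomial.C (z l)) ↔
      ∀ l, (pronyPoly c).eval (z l) = 0 := by
  classical
  constructor
  · intro h l
    rw [h, Polynomial.eval_prod]
    exact Finset.prod_eq_zero (Finset.mem_univ l) (by simp)
  · intro h
    rw [← sub_eq_zero]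
    apply Polynomial.eq_zero_of_degree_lt_of_eval_finset_eq_zero (Finset.univ.image z)
    · rw [Finset.card_image_of_injective _ hz, Finset.card_univ, Fintype.card_fin,
        ← pronyPoly_degree c]
      apply Polynomial.degree_sub_lt_left
      · rw [pronyPoly_degree, Polynomial.degree_prod]; simp
      · exact (pronyPoly_monic c).ne_zero
      · rw [(pronyPoly_monic c).leadingCoeff,
          (Polynomial.monic_prod_X_sub_C z Finset.univ).leadingCoeff]
    · intro x hx
      obtain ⟨l, _, rfl⟩ := Finset.mem_image.1 hx
      rw [Polynomial.eval_sub, h l, Polynomial.eval_prod,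
        Finset.prod_eq_zero (Finset.mem_univ l) (by simp), sub_zero]

lemma exists_pronyPoly_eq_prod (z : Fin k → ℂ) :
    ∃ c : Fin k → ℂ, pronyPoly c = ∏ l, (Polynomial.X - Polynomial.C (z l)) := by
  set p : Polynomial ℂ := ∏ l, (Polynomial.X - Polynomial.C (z l)) with hp
  have hm : p.Monic := Polynomial.monic_prod_X_sub_C z Finset.univ
  have hd : p.natDegree = k := by
    rw [hp, Polynomial.natDegree_finsetProd_X_sub_C_eq_card]; simp
  refine ⟨fun s => p.coeff s, ?_⟩
  have h := hm.as_sum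
  rw [hd, Finset.sum_range] at h
  exact h.symm

/-- The column `w` consists of the first `2 k` power moments of the nodes `z` with nonzero
weights `y`. -/
structure IsGeneric (z : Fin k → ℂ) (w : Fin (2 * k) → ℝ) (y : Fin k → ℂ) : Prop where
  moments : ∀ i : Fin (2 * k), (w i : ℂ) = ∑ l, z l ^ (i : ℕ) * y l
  ne_zero : ∀ l, y l ≠ 0

variable {z : Fin k → ℂ} {w : Fin (2 * k) → ℝ} {y : Fin k → ℂ}

/-- Entry `(i, j)` is the moment of order `i + j`, and `z ^ (i + j)` splits. The right factor is a
plain transpose, with no conjugation. -/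
lemma IsGeneric.hankel_eq (h : IsGeneric z w y) :
    hankel w = fourierMatrix k z * Matrix.diagonal y * (fourierMatrix k z)ᵀ := by
  ext i j
  rw [hankel, Matrix.of_apply, h.moments, Matrix.mul_apply]
  refine Finset.sum_congr rfl fun l _ => ?_
  simp [Matrix.mul_diagonal, fourierMatrix, pow_add]
  ring

lemma det_fourierMatrix_ne_zero (hz : Function.Injective z) : (fourierMatrix k z).det ≠ 0 := by
  have : fourierMatrix k z = (Matrix.vandermonde z)ᵀ := rfl
  rw [this, Matrix.det_transpose, Matrix.det_vandermonde_ne_zero_iff]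
  exact hz

lemma IsGeneric.det_hankel_ne_zero (h : IsGeneric z w y) (hz : Function.Injective z) :
    (hankel w).det ≠ 0 := by
  rw [h.hankel_eq, Matrix.det_mul, Matrix.det_mul, Matrix.det_transpose, Matrix.det_diagonal]
  have := det_fourierMatrix_ne_zero hz
  exact mul_ne_zero (mul_ne_zero this (Finset.prod_ne_zero_iff.2 fun l _ => h.ne_zero l)) this

/-- Row `i` of the residual collects to `∑ z_l ^ i y_l p_c(z_l)`: it is a moment vector of the
weights multiplied by the values of the polynomial. -/
lemma IsGeneric.hankel_mulVec (h : IsGeneric z w y) (c : Fin k → ℂ) :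
    hankel w *ᵥ c + shifted w = fourierMatrix k z *ᵥ fun l => y l * (pronyPoly c).eval (z l) := by
  have h1 : shifted w = fourierMatrix k z *ᵥ fun l => y l * z l ^ k := by
    ext i
    rw [shifted, h.moments, Matrix.mulVec, dotProduct]
    refine Finset.sum_congr rfl fun l _ => ?_
    simp [fourierMatrix, pow_add]
    ring
  have h2 : ((fourierMatrix k z)ᵀ *ᵥ c) = fun l => ∑ s : Fin k, c s * z l ^ (s : ℕ) := by
    ext l
    rw [Matrix.mulVec, dotProduct]
    refine Finset.sum_congr rfl fun s _ => ?_
    simp [fourierMatrix, mul_comm]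
  rw [h.hankel_eq, ← Matrix.mulVec_mulVec, ← Matrix.mulVec_mulVec, h1, ← Matrix.mulVec_add, h2]
  congr 1
  ext l
  rw [Pi.add_apply, Matrix.mulVec_diagonal, pronyPoly_eval]
  ring

/-- The square Vandermonde matrix is invertible and no weight vanishes, so a zero residual forces
the polynomial to vanish at every node. The weights drop out, hence all samples give the same
polynomial. -/
lemma IsGeneric.coeffs_iff (h : IsGeneric z w y) (hz : Function.Injective z) (c : Fin k → ℂ) :
    hankel w *ᵥ c = -shifted w ↔
      pronyPoly c = ∏ l, (Polynomial.X - Polynomial.C (z l)) := by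
  rw [eq_neg_iff_add_eq_zero, h.hankel_mulVec, pronyPoly_eq_prod_iff hz]
  constructor
  · intro h0 l
    have := congrFun (Matrix.eq_zero_of_mulVec_eq_zero (det_fourierMatrix_ne_zero hz) h0) l
    exact (mul_eq_zero.1 this).resolve_left (h.ne_zero l)
  · intro h0
    simp only [h0, mul_zero]
    exact Matrix.mulVec_zero _

lemma IsGeneric.weights_iff (h : IsGeneric z w y) (hz : Function.Injective z) (y' : Fin k → ℂ) :
    fourierMatrix k z *ᵥ y' = firstHalf w ↔ y' = y := by
  have h1 : firstHalf w = fourierMatrix k z *ᵥ y := by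
    ext i
    rw [firstHalf, h.moments]
    rfl
  rw [h1]
  constructor
  · intro h2
    rw [← sub_eq_zero]
    apply Matrix.eq_zero_of_mulVec_eq_zero (det_fourierMatrix_ne_zero hz)
    rw [Matrix.mulVec_sub, h2, sub_self]
  · rintro rfl; rfl

/-- On columns with generic weights, the algorithm has exactly one output. -/
lemma isOutput_iff_of_isGeneric {n : ℕ} (hn : 0 < n) {O : Polynomial ℂ → List ℂ}
    {z : Fin k → ℂ} (hz : Function.Injective z)
    (hOz : O (∏ l, (Polynomial.X - Polynomial.C (z l))) = List.ofFn z)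
    {W : Fin n → Fin (2 * k) → ℝ} {y : Fin n → Fin k → ℂ} (h : ∀ j, IsGeneric z (W j) (y j))
    (R : Fin k → ℂ) (D : Fin k → ℝ) :
    IsOutput O W R D ↔ R = z ∧ D = fun l => (1 / (n : ℝ)) * ∑ j, ‖y j l‖ ^ 2 := by
  constructor
  · rintro ⟨c, r, y', hstep, hR, hD⟩
    have hr : ∀ j, r j = z := by
      intro j
      have h1 := (hstep j).roots
      rw [((h j).coeffs_iff hz _).1 (hstep j).coeffs, hOz] at h1
      exact (List.ofFn_injective h1).symm
    have hy : ∀ j, y' j = y j := by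
      intro j
      have h1 := (hstep j).weights
      rw [hr] at h1
      exact ((h j).weights_iff hz _).1 h1
    refine ⟨(hR ⟨0, hn⟩ rfl).trans (hr _), ?_⟩
    ext l
    simp only [hD l, hy]
  · rintro ⟨rfl, rfl⟩
    obtain ⟨c, hc⟩ := exists_pronyPoly_eq_prod R
    refine ⟨fun _ => c, fun _ => R, y, fun j => ⟨((h j).coeffs_iff hz _).2 hc, by rw [hc, hOz],
      ((h j).weights_iff hz _).2 rfl⟩, fun _ _ => rfl, fun _ => rfl⟩

end PronyMethod

/-! ### Laplace transforms and concentration for functionals of Gaussian vectors. -/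

section Gaussian

/-- This is `-log (1 - u) ≤ u + u ^ 2`. For `u ≤ 0` the linear bound on `exp` suffices, as `(1 + u +
u ^ 2) (1 - u) = 1 - u ^ 3`; for `u ≥ 0` the quadratic term is needed. -/
lemma inv_sqrt_one_sub_le {u : ℝ} (hu : |u| ≤ 1 / 2) :
    √(1 / (1 - u)) ≤ Real.exp ((u + u ^ 2) / 2) := by
  rw [abs_le] at hu
  have h1 : 0 < 1 - u := by linarith [hu.2]
  apply Real.sqrt_le_iff.2 ⟨(Real.exp_pos _).le, ?_⟩
  rw [← Real.exp_nat_mul, div_le_iff₀ h1]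
  have h2 : ((2 : ℕ) : ℝ) * ((u + u ^ 2) / 2) = u + u ^ 2 := by push_cast; ring
  rw [h2]
  rcases le_total u 0 with h0 | h0
  · have h3 := Real.add_one_le_exp (u + u ^ 2)
    have h4 : 0 ≤ -u ^ 3 := by
      have : 0 ≤ (-u) ^ 3 := pow_nonneg (by linarith) 3
      linarith [this, show (-u) ^ 3 = -u ^ 3 by ring]
    calc (1 : ℝ) ≤ (u + u ^ 2 + 1) * (1 - u) := by linarith
      _ ≤ _ := by gcongr
  · have h3 := Real.quadratic_le_exp_of_nonneg (x := u + u ^ 2) (by positivity)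
    have h4 : 0 ≤ u ^ 2 * (1 - u - u ^ 2 - u ^ 3) := by
      apply mul_nonneg (by positivity)
      have h5 : u ^ 2 ≤ 1 / 4 := by nlinarith [hu.2]
      have h6 : u ^ 3 ≤ 1 / 4 * u := by nlinarith [hu.2]
      linarith [hu.2]
    calc (1 : ℝ) ≤ (1 + (u + u ^ 2) + (u + u ^ 2) ^ 2 / 2) * (1 - u) := by nlinarith
      _ ≤ _ := by gcongr

/-- The Laplace transform of the square of a centred Gaussian variable. -/
lemma lintegral_exp_mul_sq_gaussianReal_le (v : NNReal) (c : ℝ) (h : |2 * c * v| ≤ 1 / 2) :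
    ∫⁻ x, ENNReal.ofReal (Real.exp (c * x ^ 2)) ∂(gaussianReal 0 v) ≤
      ENNReal.ofReal (Real.exp (c * v + 2 * c ^ 2 * v ^ 2)) := by
  by_cases hv : v = 0
  · subst hv
    rw [gaussianReal_zero_var, lintegral_dirac]
    simp
  have hv' : (0 : ℝ) < v := by positivity
  have hcv : 2 * c * v < 1 := by linarith [(abs_le.1 h).2]
  have hb : 0 < 1 / (2 * (v : ℝ)) - c := by
    rw [sub_pos, lt_div_iff₀ (by positivity)]; linarith
  rw [gaussianReal_of_var_ne_zero _ hv, lintegral_withDensity_eq_lintegral_mul _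
    (measurable_gaussianPDF _ _) (by fun_prop)]
  have h1 : ∀ x : ℝ, (gaussianPDF 0 v * fun x => ENNReal.ofReal (Real.exp (c * x ^ 2))) x =
      ENNReal.ofReal ((√(2 * Real.pi * v))⁻¹ *
        Real.exp (-(1 / (2 * (v : ℝ)) - c) * x ^ 2)) := by
    intro x
    rw [Pi.mul_apply, gaussianPDF, ← ENNReal.ofReal_mul (gaussianPDFReal_nonneg _ _ _),
      gaussianPDFReal, mul_assoc, ← Real.exp_add]
    congr 4
    field_simp
    ring
  simp_rw [h1]
  rw [← ofReal_integral_eq_lintegral_ofReal ((integrable_exp_neg_mul_sq hb).const_mul _)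
    (Filter.Eventually.of_forall fun x => by positivity), integral_const_mul, integral_gaussian]
  apply ENNReal.ofReal_le_ofReal
  -- The exact transform is `(1 - u) ^ (-1 / 2)` with `u = 2 c v`, and `(u + u ^ 2) / 2 = c v + 2 c
  -- ^ 2 v ^ 2`.
  have h2 : (√(2 * Real.pi * v))⁻¹ * √(Real.pi / (1 / (2 * (v : ℝ)) - c)) =
      √(1 / (1 - 2 * c * v)) := by
    rw [← Real.sqrt_inv, ← Real.sqrt_mul (by positivity)]
    congr 1
    have : 1 - 2 * c * v ≠ 0 := by linarith
    have := Real.pi_ne_zero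
    field_simp
  rw [h2]
  refine (inv_sqrt_one_sub_le h).trans_eq ?_
  congr 1
  ring

variable {d : ℕ} (T : Matrix (Fin d) (Fin d) ℝ)

lemma map_sum_multivariateGaussian (hT : T.PosSemidef) (u : Fin d → ℝ) :
    (multivariateGaussian 0 T).map (fun x => ∑ i, u i * x i) =
      gaussianReal 0 (u ⬝ᵥ T *ᵥ u).toNNReal := by
  have h1 : (fun x : EuclideanSpace ℝ (Fin d) => ∑ i, u i * x i) =
      innerSL ℝ (WithLp.toLp 2 u : EuclideanSpace ℝ (Fin d)) := by
    ext x
    simp [PiLp.inner_apply, mul_comm]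
  rw [h1, IsGaussian.map_eq_gaussianReal]
  congr 1
  · rw [ContinuousLinearMap.integral_comp_id_comm IsGaussian.integrable_id,
      integral_id_multivariateGaussian, map_zero]
  · have := covarianceBilin_self (μ := multivariateGaussian 0 T) IsGaussian.memLp_two_id
      (WithLp.toLp 2 u)
    rw [covarianceBilin_multivariateGaussian hT] at this
    congr 1
    exact this.symm

/-- The value of the complex linear functional with coefficients `φ`. -/
noncomputable def functional (φ : Fin d → ℂ) (x : EuclideanSpace ℝ (Fin d)) : ℂ :=
  ∑ i, φ i * (x i : ℂ)

/-- The second absolute moment of `functional φ` under `N(0, T)`. -/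
noncomputable def energy (φ : Fin d → ℂ) : ℝ :=
  (fun i => (φ i).re) ⬝ᵥ T *ᵥ (fun i => (φ i).re) +
    (fun i => (φ i).im) ⬝ᵥ T *ᵥ (fun i => (φ i).im)

lemma re_functional (φ : Fin d → ℂ) (x : EuclideanSpace ℝ (Fin d)) :
    (functional φ x).re = ∑ i, (φ i).re * x i := by
  simp [functional]

lemma im_functional (φ : Fin d → ℂ) (x : EuclideanSpace ℝ (Fin d)) :
    (functional φ x).im = ∑ i, (φ i).im * x i := by
  simp [functional]

@[fun_prop]
lemma measurable_functional (φ : Fin d → ℂ) : Measurable (functional φ) := by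
  unfold functional
  fun_prop

variable {T}

/-- The mixed terms between real and imaginary parts cancel by symmetry of `T`. With the conjugate
on the right, rows of a matrix `M` yield the diagonal of `M T M^*`. -/
lemma energy_eq (hT : T.IsHermitian) (φ : Fin d → ℂ) :
    (energy T φ : ℂ) = φ ⬝ᵥ toComplex T *ᵥ star φ := by
  have hsymm : ∀ i j, T i j = T j i := fun i j => by simpa using (hT.apply i j).symm
  have hcross : ∑ i, ∑ j, (φ i).im * (T i j * (φ j).re) =
      ∑ i, ∑ j, (φ i).re * (T i j * (φ j).im) := by
    rw [Finset.sum_comm]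
    refine Finset.sum_congr rfl fun i _ => Finset.sum_congr rfl fun j _ => ?_
    rw [hsymm j i]; ring
  simp only [energy, dotProduct, Matrix.mulVec, Finset.mul_sum, toComplex, Matrix.map_apply]
  apply Complex.ext
  · simp only [Complex.ofReal_re, Complex.re_sum, ← Finset.sum_add_distrib]
    refine Finset.sum_congr rfl fun i _ => Finset.sum_congr rfl fun j _ => ?_
    simp
  · simp only [Complex.ofReal_im, Complex.im_sum]
    have : ∀ i j, (φ i * ((T i j : ℂ) * star φ j)).im =
        (φ i).im * (T i j * (φ j).re) - (φ i).re * (T i j * (φ j).im) := by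
      intro i j
      simp
      ring
    simp only [this, Finset.sum_sub_distrib, hcross, sub_self]

lemma dotProduct_nonneg (hT : T.PosSemidef) (u : Fin d → ℝ) : 0 ≤ u ⬝ᵥ T *ᵥ u := by
  simpa using hT.dotProduct_mulVec_nonneg u

lemma ae_functional_eq_zero (hT : T.PosSemidef) {φ : Fin d → ℂ} (h : energy T φ = 0) :
    ∀ᵐ x ∂(multivariateGaussian 0 T), functional φ x = 0 := by
  have key : ∀ u : Fin d → ℝ, u ⬝ᵥ T *ᵥ u = 0 →
      ∀ᵐ x ∂(multivariateGaussian 0 T), ∑ i, u i * x i = 0 := by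
    intro u hu
    have h1 := map_sum_multivariateGaussian T hT u
    rw [hu, Real.toNNReal_zero, gaussianReal_zero_var] at h1
    have h2 : ∀ᵐ y ∂((multivariateGaussian 0 T).map fun x => ∑ i, u i * x i), y = 0 := by
      rw [h1, ae_dirac_eq]; rfl
    exact ae_of_ae_map (by fun_prop) h2
  have h1 := dotProduct_nonneg hT fun i => (φ i).re
  have h2 := dotProduct_nonneg hT fun i => (φ i).im
  rw [energy] at h
  filter_upwards [key (fun i => (φ i).re) (by linarith), key (fun i => (φ i).im) (by linarith)]
    with x hx hx'
  exact Complex.ext (by rw [re_functional, hx]; rfl) (by rw [im_functional, hx']; rfl)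

/-- At least one of the real and imaginary parts has positive variance, so its law is a Gaussian
without atoms. -/
lemma ae_functional_ne_zero (hT : T.PosSemidef) {φ : Fin d → ℂ} (h : 0 < energy T φ) :
    ∀ᵐ x ∂(multivariateGaussian 0 T), functional φ x ≠ 0 := by
  have key : ∀ u : Fin d → ℝ, 0 < u ⬝ᵥ T *ᵥ u →
      ∀ᵐ x ∂(multivariateGaussian 0 T), ∑ i, u i * x i ≠ 0 := by
    intro u hu
    have h1 := map_sum_multivariateGaussian T hT u
    have : NullSingletonClass (gaussianReal 0 (u ⬝ᵥ T *ᵥ u).toNNReal) :=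
      nullSingletonClass_gaussianReal (by simpa using hu)
    have h2 : ∀ᵐ y ∂((multivariateGaussian 0 T).map fun x => ∑ i, u i * x i), y ≠ 0 := by
      rw [h1, ae_iff]
      simp
    exact ae_of_ae_map (f := fun x : EuclideanSpace ℝ (Fin d) => ∑ i, u i * x i) (by fun_prop) h2
  have h1 := dotProduct_nonneg hT fun i => (φ i).re
  have h2 := dotProduct_nonneg hT fun i => (φ i).im
  rw [energy] at h
  rcases h1.eq_or_lt with h3 | h3
  · filter_upwards [key (fun i => (φ i).im) (by linarith)] with x hx h0
    exact hx (by rw [← im_functional, h0]; rfl)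
  · filter_upwards [key (fun i => (φ i).re) h3] with x hx h0
    exact hx (by rw [← re_functional, h0]; rfl)

/-- The Laplace transform of the squared modulus of a complex linear functional of a centred
Gaussian vector. -/
lemma lintegral_exp_mul_norm_sq_functional_le (hT : T.PosSemidef) (φ : Fin d → ℂ) (t : ℝ)
    (ht : |4 * t * energy T φ| ≤ 1 / 2) :
    ∫⁻ x, ENNReal.ofReal (Real.exp (t * ‖functional φ x‖ ^ 2)) ∂(multivariateGaussian 0 T) ≤
      ENNReal.ofReal (Real.exp (t * energy T φ + 4 * t ^ 2 * energy T φ ^ 2)) := by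
  set μ := multivariateGaussian 0 T
  set v₁ := (fun i => (φ i).re) ⬝ᵥ T *ᵥ (fun i => (φ i).re) with hv₁
  set v₂ := (fun i => (φ i).im) ⬝ᵥ T *ᵥ (fun i => (φ i).im) with hv₂
  have h1 : 0 ≤ v₁ := dotProduct_nonneg hT _
  have h2 : 0 ≤ v₂ := dotProduct_nonneg hT _
  have hen : energy T φ = v₁ + v₂ := rfl
  -- Half of the logarithm of the real bound taken at exponent `2 * t`.
  set m : ℝ → ℝ := fun v => t * v + 4 * t ^ 2 * v ^ 2 with hm
  have key : ∀ (u : Fin d → ℝ), u ⬝ᵥ T *ᵥ u ≤ v₁ + v₂ →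
      ∫⁻ x, ENNReal.ofReal (Real.exp (2 * t * (∑ i, u i * x i) ^ 2)) ∂μ ≤
        ENNReal.ofReal (Real.exp (2 * m (u ⬝ᵥ T *ᵥ u))) := by
    intro u hu
    have hu0 := dotProduct_nonneg hT u
    have h3 := lintegral_exp_mul_sq_gaussianReal_le (u ⬝ᵥ T *ᵥ u).toNNReal (2 * t) (by
      rw [Real.coe_toNNReal _ hu0]
      refine le_trans ?_ ht
      rw [hen, abs_mul, abs_mul (4 * t), show 2 * (2 * t) = 4 * t by ring]
      gcongr)
    rw [← map_sum_multivariateGaussian T hT u, lintegral_map (by fun_prop) (by fun_prop)] at h3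
    refine h3.trans_eq ?_
    rw [Real.coe_toNNReal _ hu0, hm]
    congr 2
    ring
  -- Real and imaginary parts may be correlated, so the exponential of the sum is separated by a
  -- weighted arithmetic-geometric mean inequality. The weights are chosen so that both integrated
  -- terms are at most `exp (m v₁ + m v₂) / 2`.
  have hpt : ∀ x, ENNReal.ofReal (Real.exp (t * ‖functional φ x‖ ^ 2)) ≤
      ENNReal.ofReal (Real.exp (m v₂ - m v₁) / 2) *
          ENNReal.ofReal (Real.exp (2 * t * (∑ i, (φ i).re * x i) ^ 2)) +
        ENNReal.ofReal (Real.exp (m v₁ - m v₂) / 2) *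
          ENNReal.ofReal (Real.exp (2 * t * (∑ i, (φ i).im * x i) ^ 2)) := by
    intro x
    rw [← ENNReal.ofReal_mul (by positivity), ← ENNReal.ofReal_mul (by positivity),
      ← ENNReal.ofReal_add (by positivity) (by positivity)]
    apply ENNReal.ofReal_le_ofReal
    rw [← re_functional, ← im_functional, ← Complex.normSq_eq_norm_sq, Complex.normSq_apply]
    set a := (functional φ x).re
    set b := (functional φ x).im
    have e1 : Real.exp (m v₂ - m v₁) / 2 * Real.exp (2 * t * a ^ 2) =
        Real.exp ((m v₂ - m v₁) / 2 + t * a ^ 2) ^ 2 / 2 := by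
      rw [← Real.exp_nat_mul, div_mul_eq_mul_div, ← Real.exp_add]; congr 2; push_cast; ring
    have e2 : Real.exp (m v₁ - m v₂) / 2 * Real.exp (2 * t * b ^ 2) =
        Real.exp ((m v₁ - m v₂) / 2 + t * b ^ 2) ^ 2 / 2 := by
      rw [← Real.exp_nat_mul, div_mul_eq_mul_div, ← Real.exp_add]; congr 2; push_cast; ring
    have e3 : Real.exp (t * (a * a + b * b)) = Real.exp ((m v₂ - m v₁) / 2 + t * a ^ 2) *
        Real.exp ((m v₁ - m v₂) / 2 + t * b ^ 2) := by
      rw [← Real.exp_add]; congr 1; ring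
    rw [e1, e2, e3]
    have := two_mul_le_add_sq (Real.exp ((m v₂ - m v₁) / 2 + t * a ^ 2))
      (Real.exp ((m v₁ - m v₂) / 2 + t * b ^ 2))
    linarith
  refine (lintegral_mono hpt).trans ?_
  rw [lintegral_add_left (by fun_prop), lintegral_const_mul _ (by fun_prop),
    lintegral_const_mul _ (by fun_prop)]
  refine (add_le_add (mul_le_mul_right (key _ (by linarith)) _)
    (mul_le_mul_right (key _ (by linarith)) _)).trans ?_
  rw [← ENNReal.ofReal_mul (by positivity), ← ENNReal.ofReal_mul (by positivity),
    ← ENNReal.ofReal_add (by positivity) (by positivity)]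
  apply ENNReal.ofReal_le_ofReal
  rw [← hv₁, ← hv₂, div_mul_eq_mul_div, div_mul_eq_mul_div, ← Real.exp_add, ← Real.exp_add,
    show m v₂ - m v₁ + 2 * m v₁ = m v₁ + m v₂ by ring,
    show m v₁ - m v₂ + 2 * m v₂ = m v₁ + m v₂ by ring, add_halves, Real.exp_le_exp, hen, hm]
  nlinarith [mul_nonneg (sq_nonneg t) (mul_nonneg h1 h2)]

/-- Chernoff's bound for the empirical second moment of a complex linear functional. -/
lemma measure_empirical_moment_le (hT : T.PosSemidef) {φ : Fin d → ℂ} (hφ : 0 < energy T φ)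
    (n : ℕ) {ε : ℝ} (hε : 0 < ε) (hε1 : ε < 1) {σ : ℝ} (hσ : σ = 1 ∨ σ = -1) :
    samplesLaw T n {x | ε * energy T φ * n ≤
        σ * (∑ j, ‖functional φ (x j)‖ ^ 2 - n * energy T φ)} ≤
      ENNReal.ofReal (Real.exp (-(1 / 16) * n * ε ^ 2)) := by
  set D := energy T φ with hD
  -- With `s = σ t D`, the exponent per sample is `4 s ^ 2 - s ε`, minimal at `s = ε / 8` with value
  -- `-ε ^ 2 / 16`. The Laplace bound requires `4 s ≤ 1 / 2`, which follows from `ε < 1`.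
  set t : ℝ := σ * (ε / 8) / D with ht
  have hσ2 : σ ^ 2 = 1 := by rcases hσ with rfl | rfl <;> norm_num
  have htD : t * D = σ * (ε / 8) := by rw [ht]; field_simp
  set f : EuclideanSpace ℝ (Fin d) → ENNReal := fun x =>
    ENNReal.ofReal (Real.exp (t * ‖functional φ x‖ ^ 2)) with hf
  have hfm : Measurable f := by rw [hf]; fun_prop
  have hbound : ∫⁻ x, f x ∂(multivariateGaussian 0 T) ≤
      ENNReal.ofReal (Real.exp (σ * (ε / 8) + ε ^ 2 / 16)) := by
    have habs : |σ| = 1 := by rcases hσ with rfl | rfl <;> simp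
    refine (lintegral_exp_mul_norm_sq_functional_le hT φ t ?_).trans_eq ?_
    · rw [← hD, mul_assoc, htD, abs_mul, abs_mul, habs, abs_of_pos (by linarith : 0 < ε / 8),
        abs_of_pos (by norm_num : (0 : ℝ) < 4)]
      linarith
    · rw [← hD, show t * D + 4 * t ^ 2 * D ^ 2 = t * D + 4 * (t * D) ^ 2 by ring, htD, mul_pow, hσ2]
      congr 2
      ring
  have hprod : ∫⁻ x, ∏ j, f (x j) ∂(samplesLaw T n) =
      ∏ _j : Fin n, ∫⁻ x, f x ∂(multivariateGaussian 0 T) := by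
    have hind : iIndepFun (fun (j : Fin n) (x : Fin n → EuclideanSpace ℝ (Fin d)) => f (x j))
        (samplesLaw T n) := iIndepFun_pi fun _ => hfm.aemeasurable
    rw [lintegral_prod_eq_prod_lintegral_of_indepFun _ _ hind fun j => by fun_prop]
    refine Finset.prod_congr rfl fun j _ => ?_
    exact (measurePreserving_eval (fun _ : Fin n => multivariateGaussian 0 T) j).lintegral_comp hfm
  have hmarkov := mul_meas_ge_le_lintegral (μ := samplesLaw T n)
    (f := fun x => ∏ j, f (x j)) (by fun_prop)
    (ENNReal.ofReal (Real.exp (n * (σ * (ε / 8) + ε ^ 2 / 8))))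
  have hsub : {x | ε * D * n ≤ σ * (∑ j, ‖functional φ (x j)‖ ^ 2 - n * D)} ⊆
      {x : Fin n → EuclideanSpace ℝ (Fin d) |
        ENNReal.ofReal (Real.exp (n * (σ * (ε / 8) + ε ^ 2 / 8))) ≤ ∏ j, f (x j)} := by
    intro x hx
    rw [Set.mem_ofPred_eq] at hx ⊢
    rw [hf, ← ENNReal.ofReal_prod_of_nonneg fun _ _ => (Real.exp_pos _).le, ← Real.exp_sum,
      ← Finset.mul_sum]
    apply ENNReal.ofReal_le_ofReal
    rw [Real.exp_le_exp]
    have h1 := mul_le_mul_of_nonneg_left hx (by positivity : 0 ≤ ε / 8 / D)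
    have h2 : ε / 8 / D * (ε * D * n) = n * (ε ^ 2 / 8) := by field_simp
    have h3 : ε / 8 / D * (σ * (∑ j, ‖functional φ (x j)‖ ^ 2 - n * D)) =
        t * ∑ j, ‖functional φ (x j)‖ ^ 2 - n * (σ * (ε / 8)) := by
      rw [ht]; field_simp
    rw [h2, h3] at h1
    linarith
  refine (measure_mono hsub).trans ?_
  rw [mul_comm, ← ENNReal.le_div_iff_mul_le (Or.inl (by simp [Real.exp_pos]))
    (Or.inl ENNReal.ofReal_ne_top)] at hmarkov
  refine hmarkov.trans ?_
  apply ENNReal.div_le_of_le_mul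
  rw [hprod, ← ENNReal.ofReal_mul (by positivity), ← Real.exp_add, Finset.prod_const,
    Finset.card_univ, Fintype.card_fin]
  refine (pow_le_pow_left' hbound n).trans_eq ?_
  rw [← ENNReal.ofReal_pow (by positivity), ← Real.exp_nat_mul]
  congr 2
  ring

end Gaussian

/-! ### Samples as moment vectors with random weights, and the tail bound. -/

section Samples

variable {d k : ℕ} {T : Matrix (Fin d) (Fin d) ℝ}

lemma energy_row (hT : T.IsHermitian) {m : ℕ} (M : Matrix (Fin m) (Fin d) ℂ) (i : Fin m) :
    (energy T (M i) : ℂ) = (M * toComplex T * Mᴴ) i i := by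
  rw [energy_eq hT, Matrix.mul_assoc, Matrix.mul_apply, dotProduct]
  refine Finset.sum_congr rfl fun a _ => ?_
  rfl

/-- Take a left inverse `G` of `F`. Then `G T G^* = diag(D)` gives the energies, and `1 - F G`
annihilates `F`, so the part of a sample outside the column space has zero variance. -/
lemma exists_weights (hT : T.PosSemidef) (h : k ≤ d) {z : Fin k → ℂ}
    (hz : Function.Injective z) {D : Fin k → ℝ} (hTz : toComplex T = estimate d z D) :
    ∃ G : Fin k → Fin d → ℂ, (∀ l, energy T (G l) = D l) ∧
      ∀ᵐ x ∂(multivariateGaussian 0 T), ∀ i : Fin d,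
        (x i : ℂ) = ∑ l, z l ^ (i : ℕ) * functional (G l) x := by
  set F := fourierMatrix d z with hF
  have hdet := det_fourierMatrix_ne_zero hz
  obtain ⟨G, hG⟩ : ∃ G : Matrix (Fin k) (Fin d) ℂ, G * F = 1 := by
    -- `E` selects the first `k` rows, where `F` becomes an invertible square Vandermonde matrix.
    let E : Matrix (Fin k) (Fin d) ℂ := (1 : Matrix (Fin d) (Fin d) ℂ).submatrix (Fin.castLE h) id
    have hE : E * F = fourierMatrix k z := by
      ext a l
      simp [E, F, fourierMatrix, Matrix.mul_apply, Matrix.one_apply]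
    refine ⟨(fourierMatrix k z)⁻¹ * E, ?_⟩
    rw [Matrix.mul_assoc, hE, Matrix.nonsing_inv_mul _ (isUnit_iff_ne_zero.2 hdet)]
  have hGF : Fᴴ * Gᴴ = 1 := by rw [← Matrix.conjTranspose_mul, hG, Matrix.conjTranspose_one]
  refine ⟨G, fun l => ?_, ?_⟩
  · have h1 := energy_row hT.1 G l
    rw [hTz, estimate, ← hF, ← Matrix.mul_assoc, ← Matrix.mul_assoc, hG, Matrix.one_mul,
      Matrix.mul_assoc, hGF, Matrix.mul_one, Matrix.diagonal_apply_eq] at h1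
    exact_mod_cast h1
  · set N : Matrix (Fin d) (Fin d) ℂ := 1 - F * G with hN
    have hNF : N * F = 0 := by
      rw [hN, Matrix.sub_mul, Matrix.one_mul, Matrix.mul_assoc, hG, Matrix.mul_one, sub_self]
    have h0 : ∀ i, energy T (N i) = 0 := by
      intro i
      have h1 := energy_row hT.1 N i
      rw [hTz, estimate, ← hF, ← Matrix.mul_assoc, ← Matrix.mul_assoc, hNF] at h1
      simpa using h1
    rw [ae_all_iff]
    intro i
    filter_upwards [ae_functional_eq_zero hT (h0 i)] with x hx
    have h2 : functional (N i) x = (x i : ℂ) - ∑ l, z l ^ (i : ℕ) * functional (G l) x := by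
      have h3 : ∀ a, N i a = (if i = a then 1 else 0) - ∑ l, z l ^ (i : ℕ) * G l a := by
        intro a
        rw [hN, Matrix.sub_apply, Matrix.one_apply, Matrix.mul_apply]
        rfl
      simp only [functional, h3, sub_mul, Finset.sum_sub_distrib, ite_mul, one_mul, zero_mul,
        Finset.sum_ite_eq, Finset.mem_univ, if_true, Finset.sum_mul, Finset.mul_sum]
      rw [Finset.sum_comm]
      simp only [mul_assoc]
    rw [h2, sub_eq_zero] at hx
    exact hx

lemma ae_samplesLaw {p : EuclideanSpace ℝ (Fin d) → Prop}
    (h : ∀ᵐ x ∂(multivariateGaussian 0 T), p x) (n : ℕ) :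
    ∀ᵐ x ∂(samplesLaw T n), ∀ j, p (x j) := by
  rw [ae_all_iff]
  intro j
  exact (Measure.quasiMeasurePreserving_eval (fun _ : Fin n => multivariateGaussian 0 T) j).ae h

/-- The Vandermonde decomposition of the covariance matrix, with nodes in the order of the oracle,
and the linear functionals giving the weights of a sample. -/
lemma exists_model (h : 2 * k ≤ d) {O : Polynomial ℂ → List ℂ} (hT : T.PosSemidef)
    (hTo : IsToeplitz T) (hrank : T.rank = k) (hO : IsRootOracle k O) :
    ∃ (z : Fin k → ℂ) (D : Fin k → ℝ) (G : Fin k → Fin d → ℂ), Function.Injective z ∧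
      (∀ l, ‖z l‖ = 1) ∧ O (∏ l, (Polynomial.X - Polynomial.C (z l))) = List.ofFn z ∧
      (∀ l, 0 < D l) ∧ toComplex T = estimate d z D ∧ (∀ l, energy T (G l) = D l) ∧
      ∀ n, ∀ᵐ x ∂(samplesLaw T n), ∀ j,
        IsGeneric z (firstEntries h x j) fun l => functional (G l) (x j) := by
  subst hrank
  obtain ⟨z, D, hz, hz1, hD, hTz⟩ := exists_fourier_decomposition T hT hTo
  obtain ⟨σ, hσ⟩ := exists_oracle_order hO hz hz1
  -- Nodes and weights are permuted together: neither the matrix nor the root polynomial changes,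
  -- and the oracle now lists the nodes in their own order.
  have hzσ : Function.Injective (z ∘ σ) := hz.comp σ.injective
  have hTσ : toComplex T = estimate d (z ∘ σ) (D ∘ σ) := by rw [estimate_comp_equiv, hTz]
  obtain ⟨G, hG, hx⟩ := exists_weights hT (by omega) hzσ hTσ
  refine ⟨z ∘ σ, D ∘ σ, G, hzσ, fun l => hz1 _, ?_, fun l => hD _, hTσ, hG, fun n => ?_⟩
  · rw [← hσ]
    congr 1
    exact Equiv.prod_comp σ fun l => Polynomial.X - Polynomial.C (z l)
  · have hne : ∀ᵐ x ∂(multivariateGaussian 0 T), ∀ l, functional (G l) x ≠ 0 := by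
      rw [ae_all_iff]
      exact fun l => ae_functional_ne_zero hT (by rw [hG]; exact hD _)
    filter_upwards [ae_samplesLaw hx n, ae_samplesLaw hne n] with x h1 h2 j
    exact ⟨fun i => h1 j (Fin.castLE h i), h2 j⟩

lemma exists_frequency {w : ℂ} (hw : ‖w‖ = 1) :
    ∃ f : ℝ, f ∈ Set.Ico (0 : ℝ) 1 ∧ w = Complex.exp (-2 * Real.pi * Complex.I * f) := by
  set t : ℝ := -(Complex.arg w) / (2 * Real.pi) with ht
  refine ⟨Int.fract t, ⟨Int.fract_nonneg _, Int.fract_lt_one _⟩, ?_⟩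
  have h1 : w = Complex.exp (Complex.arg w * Complex.I) := by
    have := Complex.norm_mul_exp_arg_mul_I w
    rw [hw] at this
    simpa using this.symm
  have hpi : (Real.pi : ℂ) ≠ 0 := by exact_mod_cast Real.pi_ne_zero
  have h2 : -2 * Real.pi * Complex.I * (Int.fract t : ℝ) =
      Complex.arg w * Complex.I + (⌊t⌋ : ℤ) * (2 * Real.pi * Complex.I) := by
    rw [Int.fract, ht]
    push_cast
    field_simp
    ring
  rw [h2, Complex.exp_add, Complex.exp_int_mul_two_pi_mul_I, mul_one]
  exact h1

lemma samplesLaw_failure_le (h : 2 * k ≤ d) {O : Polynomial ℂ → List ℂ} (hT : T.PosSemidef)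
    (hTo : IsToeplitz T) (hrank : T.rank = k) (hO : IsRootOracle k O) {n : ℕ} (hn : 0 < n)
    {ε : ℝ} (hε : 0 < ε) (hε1 : ε < 1) :
    samplesLaw T n (failure h T O n ε) ≤
      ENNReal.ofReal (2 * k * Real.exp (-(1 / 16) * n * ε ^ 2)) := by
  obtain ⟨z, D, G, hz, _, hOz, hD, hTz, hG, hgen⟩ := exists_model h hT hTo hrank hO
  set S : Fin k → ℝ → Set (Fin n → EuclideanSpace ℝ (Fin d)) := fun l σ =>
    {x | ε * energy T (G l) * n ≤ σ * (∑ j, ‖functional (G l) (x j)‖ ^ 2 - n * energy T (G l))}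
    with hS
  -- Off the null set of degenerate samples the nodes are exact, so failure forces some weight to
  -- have relative error at least `ε`, upwards (`σ = 1`) or downwards (`σ = -1`).
  have hsub : failure h T O n ε ≤ᵐ[samplesLaw T n] ⋃ l, (S l 1 ∪ S l (-1)) := by
    filter_upwards [hgen n] with x hx hfail
    obtain ⟨R, E, hout, hlt⟩ := hfail
    obtain ⟨rfl, rfl⟩ := (isOutput_iff_of_isGeneric hn hz hOz hx R E).1 hout
    by_contra hnot
    have hnot : x ∉ ⋃ l, (S l 1 ∪ S l (-1)) := hnot
    simp only [Set.mem_iUnion, Set.mem_union, hS, Set.mem_ofPred_eq, not_exists, not_or, not_le,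
      hG] at hnot
    refine hlt.not_ge ?_
    rw [hTz]
    refine specNorm_estimate_le R hε.le hD fun l => ?_
    obtain ⟨h1, h2⟩ := hnot l
    have hn' : (0 : ℝ) < n := by exact_mod_cast hn
    rw [abs_sub_comm, abs_le]
    have e : 1 / (n : ℝ) * ∑ j, ‖functional (G l) (x j)‖ ^ 2 - D l =
        (∑ j, ‖functional (G l) (x j)‖ ^ 2 - n * D l) / n := by field_simp
    rw [e, le_div_iff₀ hn', div_le_iff₀ hn']
    constructor <;> linarith
  refine (measure_mono_ae hsub).trans ((measure_iUnion_le _).trans ?_)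
  have hl : ∀ l, samplesLaw T n (S l 1 ∪ S l (-1)) ≤
      ENNReal.ofReal (2 * Real.exp (-(1 / 16) * n * ε ^ 2)) := by
    intro l
    have hpos : 0 < energy T (G l) := by rw [hG]; exact hD l
    refine (measure_union_le _ _).trans ?_
    rw [two_mul, ENNReal.ofReal_add (by positivity) (by positivity)]
    exact add_le_add (measure_empirical_moment_le hT hpos n hε hε1 (Or.inl rfl))
      (measure_empirical_moment_le hT hpos n hε hε1 (Or.inr rfl))
  rw [tsum_fintype]
  refine (Finset.sum_le_sum fun l _ => hl l).trans_eq ?_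
  rw [Finset.sum_const, Finset.card_univ, Fintype.card_fin, nsmul_eq_mul,
    show (2 : ℝ) * k * Real.exp (-(1 / 16) * n * ε ^ 2) =
      k * (2 * Real.exp (-(1 / 16) * n * ε ^ 2)) by ring,
    ENNReal.ofReal_mul (Nat.cast_nonneg k), ENNReal.ofReal_natCast]

end Samples

/-! ### Syntactic bounds on the effects and resources of programs. -/

section Machine

namespace Cmd

/-- The index registers a program may write to. -/
def regs : Cmd → List ℕ
  | .idxConst x _ => [x]
  | .idxAdd x _ _ => [x]
  | .idxSub x _ _ => [x]
  | .seq p q => p.regs ++ q.regs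
  | .ifZero _ p q => p.regs ++ q.regs
  | .ifLt _ _ p q => p.regs ++ q.regs
  | .loop x _ p => x :: p.regs
  | _ => []

/-- The arrays a program may write to. -/
def arrs : Cmd → List ℕ
  | .const u _ => [u.arr]
  | .add u _ _ => [u.arr]
  | .sub u _ _ => [u.arr]
  | .mul u _ _ => [u.arr]
  | .div u _ _ => [u.arr]
  | .conj u _ => [u.arr]
  | .read u _ _ => [u.arr]
  | .query _ B _ => [B]
  | .seq p q => p.arrs ++ q.arrs
  | .ifZero _ p q => p.arrs ++ q.arrs
  | .ifLt _ _ p q => p.arrs ++ q.arrs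
  | .loop _ _ p => p.arrs
  | _ => []

/-- The index registers that bound the loops of a program. -/
def bounds : Cmd → List ℕ
  | .seq p q => p.bounds ++ q.bounds
  | .ifZero _ p q => p.bounds ++ q.bounds
  | .ifLt _ _ p q => p.bounds ++ q.bounds
  | .loop _ b p => b :: p.bounds
  | _ => []

/-- The program contains no instruction that reads a sample entry. -/
def readFree : Cmd → Bool
  | .read _ _ _ => false
  | .seq p q => p.readFree && q.readFree
  | .ifZero _ p q => p.readFree && q.readFree
  | .ifLt _ _ p q => p.readFree && q.readFree
  | .loop _ _ p => p.readFree
  | _ => true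

/-- The program contains no oracle query. -/
def queryFree : Cmd → Bool
  | .query _ _ _ => false
  | .seq p q => p.queryFree && q.queryFree
  | .ifZero _ p q => p.queryFree && q.queryFree
  | .ifLt _ _ p q => p.queryFree && q.queryFree
  | .loop _ _ p => p.queryFree
  | _ => true

/-- A bound for the number of steps of a program all of whose loops have at most `N` rounds. -/
def cost (N : ℕ) : Cmd → ℕ
  | .seq p q => p.cost N + q.cost N
  | .ifZero _ p q => 1 + p.cost N + q.cost N
  | .ifLt _ _ p q => 1 + p.cost N + q.cost N
  | .loop _ _ p => 1 + N * (1 + p.cost N)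
  | _ => 1

/-- The number of instructions of a program, loops counted twice. -/
def size : Cmd → ℕ
  | .seq p q => p.size + q.size
  | .ifZero _ p q => 1 + p.size + q.size
  | .ifLt _ _ p q => 1 + p.size + q.size
  | .loop _ _ p => 2 + p.size
  | _ => 1

/-- The nesting depth of the loops of a program. -/
def depth : Cmd → ℕ
  | .seq p q => max p.depth q.depth
  | .ifZero _ p q => max p.depth q.depth
  | .ifLt _ _ p q => max p.depth q.depth
  | .loop _ _ p => p.depth + 1
  | _ => 0

/-- Each nesting level costs one factor `N`. The overhead `1 + N` of a loop is at most `2 N ^ (depth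
+ 1)`, which is why `size` counts a loop twice. -/
lemma cost_le_size_mul_pow {N : ℕ} (hN : 1 ≤ N) (p : Cmd) : p.cost N ≤ p.size * N ^ p.depth := by
  have hpow : ∀ a b : ℕ, a ≤ b → N ^ a ≤ N ^ b := fun a b h => Nat.pow_le_pow_right hN h
  have h1 : ∀ a, 1 ≤ N ^ a := fun a => Nat.one_le_pow _ _ hN
  induction p with
  | seq p q ihp ihq =>
    simp only [cost, size, depth]
    have e1 := Nat.mul_le_mul_left p.size (hpow _ _ (le_max_left p.depth q.depth))
    have e2 := Nat.mul_le_mul_left q.size (hpow _ _ (le_max_right p.depth q.depth))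
    linarith
  | ifZero u p q ihp ihq =>
    simp only [cost, size, depth]
    have e1 := Nat.mul_le_mul_left p.size (hpow _ _ (le_max_left p.depth q.depth))
    have e2 := Nat.mul_le_mul_left q.size (hpow _ _ (le_max_right p.depth q.depth))
    have e3 := h1 (max p.depth q.depth)
    linarith
  | ifLt x y p q ihp ihq =>
    simp only [cost, size, depth]
    have e1 := Nat.mul_le_mul_left p.size (hpow _ _ (le_max_left p.depth q.depth))
    have e2 := Nat.mul_le_mul_left q.size (hpow _ _ (le_max_right p.depth q.depth))
    have e3 := h1 (max p.depth q.depth)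
    linarith
  | loop x b p ih =>
    simp only [cost, size, depth]
    have e1 := Nat.mul_le_mul_left N ih
    have e2 : N * 1 ≤ N * N ^ p.depth := Nat.mul_le_mul_left N (h1 _)
    have e3 := h1 (p.depth + 1)
    have e4 : N ^ (p.depth + 1) = N * N ^ p.depth := by rw [pow_succ, mul_comm]
    rw [e4] at *
    nlinarith
  | _ => simp [cost, size, depth]

end Cmd

variable {O : Polynomial ℂ → List ℂ} {X : ℕ → ℕ → ℝ}

lemma foldl_range_induction {α : Type*} (f : α → ℕ → α) (P : ℕ → α → Prop) (a : α) (N : ℕ)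
    (h0 : P 0 a) (hs : ∀ i < N, ∀ b, P i b → P (i + 1) (f b i)) :
    P N ((List.range N).foldl f a) := by
  induction N with
  | zero => simpa using h0
  | succ N ih =>
    rw [List.range_succ, List.foldl_append]
    exact hs N (Nat.lt_succ_self N) _ (ih fun i hi => hs i (Nat.lt_succ_of_lt hi))

lemma exec_loop_induction {x b : ℕ} {p : Cmd} {s : Config} (P : ℕ → Config → Prop)
    (h0 : P 0 s.tick)
    (hs : ∀ i < s.idx b, ∀ t, P i t → P (i + 1) (exec O X p (t.tick.setIdx x i))) :
    P (s.idx b) (exec O X (.loop x b p) s) :=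
  foldl_range_induction _ P _ _ h0 hs

/-- A frame rule with a purely syntactic hypothesis, which `decide` settles for concrete programs.
-/
lemma exec_idx (p : Cmd) (s : Config) {x : ℕ} (h : x ∉ p.regs) :
    (exec O X p s).idx x = s.idx x := by
  induction p generalizing s with
  | seq p q ihp ihq =>
    simp only [Cmd.regs, List.mem_append, not_or] at h
    rw [exec, ihq _ h.2, ihp _ h.1]
  | ifZero u p q ihp ihq =>
    simp only [Cmd.regs, List.mem_append, not_or] at h
    rw [exec]
    split_ifs
    · exact ihp _ h.1
    · exact ihq _ h.2
  | ifLt y z p q ihp ihq =>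
    simp only [Cmd.regs, List.mem_append, not_or] at h
    rw [exec]
    split_ifs
    · exact ihp _ h.1
    · exact ihq _ h.2
  | loop y b p ih =>
    simp only [Cmd.regs, List.mem_cons, not_or] at h
    refine exec_loop_induction (fun _ t => t.idx x = s.idx x) rfl fun i _ t ht => ?_
    rw [ih _ h.2, ← ht]
    exact Function.update_of_ne h.1 _ _
  | idxConst y m => exact Function.update_of_ne (by simpa [Cmd.regs] using h) _ _
  | idxAdd y _ _ => exact Function.update_of_ne (by simpa [Cmd.regs] using h) _ _
  | idxSub y _ _ => exact Function.update_of_ne (by simpa [Cmd.regs] using h) _ _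
  | _ => rfl

lemma set_mem_of_ne {s : Config} {u : Loc} {v : ℂ} {A : ℕ} (h : A ≠ u.arr) :
    (s.set u v).mem A = s.mem A := by
  funext i j
  simp [Config.set, h]

lemma exec_mem (p : Cmd) (s : Config) {A : ℕ} (h : A ∉ p.arrs) :
    (exec O X p s).mem A = s.mem A := by
  induction p generalizing s with
  | seq p q ihp ihq =>
    simp only [Cmd.arrs, List.mem_append, not_or] at h
    rw [exec, ihq _ h.2, ihp _ h.1]
  | ifZero u p q ihp ihq =>
    simp only [Cmd.arrs, List.mem_append, not_or] at h
    rw [exec]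
    split_ifs
    · exact ihp _ h.1
    · exact ihq _ h.2
  | ifLt y z p q ihp ihq =>
    simp only [Cmd.arrs, List.mem_append, not_or] at h
    rw [exec]
    split_ifs
    · exact ihp _ h.1
    · exact ihq _ h.2
  | loop y b p ih =>
    simp only [Cmd.arrs] at h
    refine exec_loop_induction (fun _ t => t.mem A = s.mem A) rfl fun i _ t ht => ?_
    rw [ih _ h, ← ht]
    rfl
  | idxConst _ _ => rfl
  | idxAdd _ _ _ => rfl
  | idxSub _ _ _ => rfl
  | query _ B _ =>
    have hB : A ≠ B := by simpa [Cmd.arrs] using h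
    funext i j
    simp [exec, Config.setRow, Config.tick, hB]
  | _ => exact set_mem_of_ne (by simpa [Cmd.arrs] using h)

lemma exec_reads (p : Cmd) (s : Config) (h : p.readFree = true) :
    (exec O X p s).reads = s.reads := by
  induction p generalizing s with
  | seq p q ihp ihq =>
    simp only [Cmd.readFree, Bool.and_eq_true] at h
    rw [exec, ihq _ h.2, ihp _ h.1]
  | ifZero u p q ihp ihq =>
    simp only [Cmd.readFree, Bool.and_eq_true] at h
    rw [exec]
    split_ifs
    · exact ihp _ h.1
    · exact ihq _ h.2
  | ifLt y z p q ihp ihq =>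
    simp only [Cmd.readFree, Bool.and_eq_true] at h
    rw [exec]
    split_ifs
    · exact ihp _ h.1
    · exact ihq _ h.2
  | loop y b p ih =>
    simp only [Cmd.readFree] at h
    refine exec_loop_induction (fun _ t => t.reads = s.reads) rfl fun i _ t ht => ?_
    rw [ih _ h, ← ht]
    rfl
  | read _ _ _ => simp [Cmd.readFree] at h
  | _ => rfl

lemma exec_queries (p : Cmd) (s : Config) (h : p.queryFree = true) :
    (exec O X p s).queries = s.queries := by
  induction p generalizing s with
  | seq p q ihp ihq =>
    simp only [Cmd.queryFree, Bool.and_eq_true] at h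
    rw [exec, ihq _ h.2, ihp _ h.1]
  | ifZero u p q ihp ihq =>
    simp only [Cmd.queryFree, Bool.and_eq_true] at h
    rw [exec]
    split_ifs
    · exact ihp _ h.1
    · exact ihq _ h.2
  | ifLt y z p q ihp ihq =>
    simp only [Cmd.queryFree, Bool.and_eq_true] at h
    rw [exec]
    split_ifs
    · exact ihp _ h.1
    · exact ihq _ h.2
  | loop y b p ih =>
    simp only [Cmd.queryFree] at h
    refine exec_loop_induction (fun _ t => t.queries = s.queries) rfl fun i _ t ht => ?_
    rw [ih _ h, ← ht]
    rfl
  | query _ _ _ => simp [Cmd.queryFree] at h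
  | _ => rfl

/-- If the registers that bound loops are never written and hold at most `N`, then the number of
steps is at most `cost N`. -/
lemma exec_steps_le {N : ℕ} (p : Cmd) (s : Config) {B : List ℕ} (hB : ∀ b ∈ B, s.idx b ≤ N)
    (hp : ∀ b ∈ p.bounds, b ∈ B) (hreg : ∀ b ∈ B, b ∉ p.regs) :
    (exec O X p s).steps ≤ s.steps + p.cost N := by
  induction p generalizing s with
  | seq p q ihp ihq =>
    simp only [Cmd.regs, Cmd.bounds, List.mem_append, not_or] at hp hreg
    have h1 := ihp s hB (fun b hb => hp b (Or.inl hb)) (fun b hb => (hreg b hb).1)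
    have h2 := ihq (exec O X p s) (fun b hb => by rw [exec_idx _ _ (hreg b hb).1]; exact hB b hb)
      (fun b hb => hp b (Or.inr hb)) (fun b hb => (hreg b hb).2)
    simp only [exec, Cmd.cost]
    omega
  | ifZero u p q ihp ihq =>
    simp only [Cmd.regs, Cmd.bounds, List.mem_append, not_or] at hp hreg
    have h1 := ihp s.tick hB (fun b hb => hp b (Or.inl hb)) (fun b hb => (hreg b hb).1)
    have h2 := ihq s.tick hB (fun b hb => hp b (Or.inr hb)) (fun b hb => (hreg b hb).2)
    have h3 : s.tick.steps = s.steps + 1 := rfl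
    simp only [exec, Cmd.cost]
    split_ifs <;> omega
  | ifLt y z p q ihp ihq =>
    simp only [Cmd.regs, Cmd.bounds, List.mem_append, not_or] at hp hreg
    have h1 := ihp s.tick hB (fun b hb => hp b (Or.inl hb)) (fun b hb => (hreg b hb).1)
    have h2 := ihq s.tick hB (fun b hb => hp b (Or.inr hb)) (fun b hb => (hreg b hb).2)
    have h3 : s.tick.steps = s.steps + 1 := rfl
    simp only [exec, Cmd.cost]
    split_ifs <;> omega
  | loop y b p ih =>
    simp only [Cmd.regs, Cmd.bounds, List.mem_cons, not_or] at hp hreg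
    have hb : s.idx b ≤ N := hB b (hp b (Or.inl rfl))
    have key := exec_loop_induction (O := O) (X := X) (x := y) (b := b) (p := p) (s := s)
      (fun i t => t.steps ≤ s.steps + 1 + i * (1 + p.cost N) ∧ ∀ b ∈ B, t.idx b ≤ N)
      ⟨by simp [Config.tick], hB⟩ (fun i _ t ht => by
        have hB' : ∀ b ∈ B, (t.tick.setIdx y i).idx b ≤ N := fun b hb => by
          have h1 : (t.tick.setIdx y i).idx b = t.idx b := Function.update_of_ne (hreg b hb).1 _ _
          rw [h1]; exact ht.2 b hb
        refine ⟨?_, fun b hb => by rw [exec_idx _ _ (hreg b hb).2]; exact hB' b hb⟩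
        have h1 := ih (t.tick.setIdx y i) hB' (fun b hb => hp b (Or.inr hb))
          (fun b hb => (hreg b hb).2)
        have h2 : (t.tick.setIdx y i).steps = t.steps + 1 := rfl
        have h3 := ht.1
        rw [add_mul, one_mul]
        omega)
    have h4 := Nat.mul_le_mul_right (1 + p.cost N) hb
    have h5 := key.1
    simp only [Cmd.cost]
    omega
  | _ => exact le_rfl

/-- Induction over the rounds of a loop, for assertions about the memory; the index registers and
arrays that the body does not write to are unchanged. -/
lemma exec_loop_mem {x b : ℕ} {p : Cmd} {s : Config} (P : ℕ → (ℕ → ℕ → ℕ → ℂ) → Prop)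
    (h0 : P 0 s.mem)
    (hs : ∀ i < s.idx b, ∀ t : Config, (∀ y, y ∉ (Cmd.loop x b p).regs → t.idx y = s.idx y) →
      t.idx x = i → (∀ A, A ∉ p.arrs → t.mem A = s.mem A) → P i t.mem →
      P (i + 1) (exec O X p t).mem) :
    P (s.idx b) (exec O X (.loop x b p) s).mem := by
  have key := exec_loop_induction (O := O) (X := X) (x := x) (b := b) (p := p) (s := s)
    (fun i t => P i t.mem ∧ (∀ y, y ∉ (Cmd.loop x b p).regs → t.idx y = s.idx y) ∧
      ∀ A, A ∉ p.arrs → t.mem A = s.mem A)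
    ⟨h0, fun _ _ => rfl, fun _ _ => rfl⟩ (fun i hi t ht => by
      obtain ⟨h1, h2, h3⟩ := ht
      have h4 : ∀ y, y ∉ (Cmd.loop x b p).regs → (t.tick.setIdx x i).idx y = s.idx y := by
        intro y hy
        have hyx : y ≠ x := by
          rintro rfl; exact hy (by simp [Cmd.regs])
        rw [← h2 y hy]
        exact Function.update_of_ne hyx _ _
      refine ⟨hs i hi _ h4 (Function.update_self _ _ _) h3 h1, fun y hy => ?_, fun A hA => ?_⟩
      · rw [exec_idx, h4 y hy]
        intro h
        exact hy (by simp [Cmd.regs, h])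
      · rw [exec_mem _ _ hA]
        exact h3 A hA)
  exact key.1

end Machine

/-! ### Linear systems by successive orthogonal projection. -/

section Solver

variable {k : ℕ}

/-- The state of the row projection method for `A c = b` after `i` rows: `H` is the orthogonal
projection onto the complement of the conjugates of the first `i` rows of `A`, and `c` solves the
first `i` equations. -/
structure IsPartialSolution (A : Matrix (Fin k) (Fin k) ℂ) (b : Fin k → ℂ) (i : ℕ)
    (H : Matrix (Fin k) (Fin k) ℂ) (c : Fin k → ℂ) : Prop where
  herm : Hᴴ = H
  idem : H * H = H
  annihilates : ∀ j : Fin k, (j : ℕ) < i → A j ᵥ* H = 0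
  solves : ∀ j : Fin k, (j : ℕ) < i → A j ⬝ᵥ c = b j
  sub_mem : ∀ v, v - H *ᵥ v ∈ Submodule.span ℂ {u | ∃ j : Fin k, (j : ℕ) < i ∧ u = star (A j)}

variable {A : Matrix (Fin k) (Fin k) ℂ} {b : Fin k → ℂ}

lemma isPartialSolution_zero : IsPartialSolution A b 0 1 0 where
  herm := Matrix.conjTranspose_one
  idem := Matrix.one_mul 1
  annihilates := fun j hj => absurd hj (Nat.not_lt_zero _)
  solves := fun j hj => absurd hj (Nat.not_lt_zero _)
  sub_mem := fun v => by simp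

lemma star_row_notMem_span (hA : A.det ≠ 0) (i : Fin k) :
    star (A i) ∉ Submodule.span ℂ {u | ∃ j : Fin k, (j : ℕ) < i ∧ u = star (A j)} := by
  have hli : LinearIndependent ℂ fun j => star (A j) := by
    have h1 : (A.map star).det ≠ 0 := by
      have : A.map star = Aᴴᵀ := by ext; rfl
      rw [this, Matrix.det_transpose, Matrix.det_conjTranspose]
      simpa using hA
    exact Matrix.linearIndependent_rows_of_det_ne_zero h1
  have h2 := hli.notMem_span_image (s := {j : Fin k | j < i}) (x := i) (by simp)
  convert h2 using 4
  ext u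
  constructor
  · rintro ⟨j, hj, rfl⟩; exact ⟨j, hj, rfl⟩
  · rintro ⟨j, hj, rfl⟩; exact ⟨j, hj, rfl⟩

/-- The vector `s` is the part of the new conjugate row orthogonal to the earlier ones. Moving `c`
along `s` repairs equation `i` without disturbing the previous equations, and removing the line of
`s` from `H` restores the invariant. -/
lemma IsPartialSolution.succ {i : Fin k} {H : Matrix (Fin k) (Fin k) ℂ} {c s : Fin k → ℂ} {α : ℂ}
    (h : IsPartialSolution A b i H c) (hA : A.det ≠ 0) (hs : s = H *ᵥ star (A i))
    (hα : α = A i ⬝ᵥ s) :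
    IsPartialSolution A b (i + 1) (H - α⁻¹ • vecMulVec s (star s))
      (c - ((A i ⬝ᵥ c - b i) / α) • s) := by
  have hrow : A i ᵥ* H = star s := by
    rw [hs, Matrix.star_mulVec, star_star, h.herm]
  have hHs : H *ᵥ s = s := by rw [hs, Matrix.mulVec_mulVec, h.idem]
  have hsH : star s ᵥ* H = star s := by
    rw [← hrow, Matrix.vecMul_vecMul, h.idem]
  have hαs : α = star s ⬝ᵥ s := by
    rw [← hrow, ← Matrix.dotProduct_mulVec, hHs, hα]
  -- Here `α` is the squared norm of `s`. If it vanished, the new conjugate row would lie in the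
  -- span of the earlier ones, against the invertibility of `A`.
  have hα0 : α ≠ 0 := by
    intro h0
    have hs0 : s = 0 := by
      rw [hαs] at h0
      open scoped ComplexOrder in
      exact dotProduct_star_self_eq_zero.1 h0
    have h1 := h.sub_mem (star (A i))
    rw [← hs, hs0, sub_zero] at h1
    exact star_row_notMem_span hA i h1
  have hαstar : star α = α := by
    rw [hαs, ← Matrix.star_dotProduct]
  have hprev : ∀ j : Fin k, (j : ℕ) < i → A j ⬝ᵥ s = 0 := by
    intro j hj
    rw [hs, Matrix.dotProduct_mulVec, h.annihilates j hj, zero_dotProduct]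
  have hmono : Submodule.span ℂ {u | ∃ j : Fin k, (j : ℕ) < i ∧ u = star (A j)} ≤
      Submodule.span ℂ {u | ∃ j : Fin k, (j : ℕ) < i + 1 ∧ u = star (A j)} :=
    Submodule.span_mono fun u ⟨j, hj, hu⟩ => ⟨j, Nat.lt_succ_of_lt hj, hu⟩
  refine ⟨?_, ?_, ?_, ?_, ?_⟩
  · rw [Matrix.conjTranspose_sub, Matrix.conjTranspose_smul, h.herm, star_inv₀, hαstar,
      Matrix.conjTranspose_vecMulVec, star_star]
  · have e1 : H * vecMulVec s (star s) = vecMulVec s (star s) := by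
      rw [Matrix.mul_vecMulVec, hHs]
    have e2 : vecMulVec s (star s) * H = vecMulVec s (star s) := by
      rw [Matrix.vecMulVec_mul, hsH]
    have e3 : vecMulVec s (star s) * vecMulVec s (star s) = α • vecMulVec s (star s) := by
      rw [Matrix.vecMulVec_mul_vecMulVec, ← hαs, Matrix.vecMulVec_smul]
    rw [Matrix.sub_mul, Matrix.mul_sub, Matrix.mul_sub, h.idem, Matrix.mul_smul, Matrix.smul_mul,
      Matrix.smul_mul, Matrix.mul_smul, e1, e2, e3, smul_smul, smul_smul]
    field_simp
    simp
  · intro j hj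
    rw [Matrix.vecMul_sub, Matrix.vecMul_smul, Matrix.vecMul_vecMulVec]
    rcases Nat.lt_succ_iff_lt_or_eq.1 hj with hj | hj
    · rw [h.annihilates j hj, hprev j hj]
      simp
    · obtain rfl : j = i := Fin.ext hj
      rw [hrow, ← hα, smul_smul, inv_mul_cancel₀ hα0, one_smul, sub_self]
  · intro j hj
    rw [dotProduct_sub, dotProduct_smul]
    rcases Nat.lt_succ_iff_lt_or_eq.1 hj with hj | hj
    · rw [h.solves j hj, hprev j hj]
      simp
    · obtain rfl : j = i := Fin.ext hj
      rw [← hα, smul_eq_mul, div_mul_cancel₀ _ hα0]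
      ring
  · intro v
    have hsmem : s ∈ Submodule.span ℂ {u | ∃ j : Fin k, (j : ℕ) < i + 1 ∧ u = star (A j)} := by
      have h1 := hmono (h.sub_mem (star (A i)))
      rw [← hs] at h1
      have h2 : star (A i) ∈
          Submodule.span ℂ {u | ∃ j : Fin k, (j : ℕ) < i + 1 ∧ u = star (A j)} :=
        Submodule.subset_span ⟨i, Nat.lt_succ_self _, rfl⟩
      have := Submodule.sub_mem _ h2 h1
      rwa [sub_sub_cancel] at this
    rw [Matrix.sub_mulVec, Matrix.smul_mulVec, Matrix.vecMulVec_mulVec, sub_sub_eq_add_sub,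
      add_sub_right_comm]
    refine Submodule.add_mem _ (hmono (h.sub_mem v)) (Submodule.smul_mem _ _ ?_)
    simpa using Submodule.smul_mem _ _ hsmem

lemma IsPartialSolution.mulVec_eq {H : Matrix (Fin k) (Fin k) ℂ} {c : Fin k → ℂ}
    (h : IsPartialSolution A b k H c) : A *ᵥ c = b :=
  funext fun j => h.solves j j.2

end Solver

/-! ### The program, and what its linear solver does to memory. -/

section Program

/-! Index registers: `0` and `1` hold `k` and `n`, register `2` is never written and holds `0`,
`4` counts samples, `5`, `6`, `7` are loop counters, `8` is auxiliary and `9` holds `1`.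

Arrays: `0` nodes, `1` weights, `2` samples, `3` and `4` matrix and right-hand side of a linear
system, `5` its solution, `6`, `7`, `8`, `9`, `10`, `11`, `12`, `13` work space, `14` is never
written and holds zeros, `15` counts samples. -/

/-- Reads the first `2 k` entries of all samples into array `2`. -/
def readSamples : Cmd :=
  .loop 4 1 <| .loop 5 0 <| .seq (.read ⟨2, 5, 4⟩ 5 4) <| .seq (.idxAdd 8 0 5) <|
    .read ⟨2, 8, 4⟩ 8 4

/-- Writes `∑ u * v` to array `8`, where the sum is over `k` values of register `7`. -/
def sumMul (u v : Loc) : Cmd :=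
  .seq (.const ⟨8, 2, 2⟩ 0) <|
    .loop 7 0 <| .seq (.mul ⟨9, 2, 2⟩ u v) <| .add ⟨8, 2, 2⟩ ⟨8, 2, 2⟩ ⟨9, 2, 2⟩

/-- Initializes the row projection method with solution `0` and projection `1`. -/
def solveInit : Cmd :=
  .seq (.loop 6 0 <| .const ⟨5, 2, 6⟩ 0) <|
    .seq (.loop 6 0 <| .loop 7 0 <| .const ⟨6, 6, 7⟩ 0) <| .loop 6 0 <| .const ⟨6, 6, 6⟩ 1

/-- Copies the conjugate of the current row to array `10`. -/
def conjRow : Cmd := .loop 6 0 <| .conj ⟨10, 2, 6⟩ ⟨3, 5, 6⟩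

/-- Applies the projection to array `10`, with result in array `7`. -/
def projRow : Cmd :=
  .loop 6 0 <| .seq (sumMul ⟨6, 6, 7⟩ ⟨10, 2, 7⟩) <| .add ⟨7, 2, 6⟩ ⟨8, 2, 2⟩ ⟨14, 2, 2⟩

/-- Writes the residual of the current equation to array `11`. -/
def residual : Cmd :=
  .seq (sumMul ⟨3, 5, 7⟩ ⟨5, 2, 7⟩) <| .sub ⟨11, 2, 2⟩ ⟨8, 2, 2⟩ ⟨4, 2, 5⟩

/-- Divides array `11` by the product of the current row with array `7`, which is left in array
`8`. -/
def stepSize : Cmd :=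
  .seq (sumMul ⟨3, 5, 7⟩ ⟨7, 2, 7⟩) <| .div ⟨11, 2, 2⟩ ⟨11, 2, 2⟩ ⟨8, 2, 2⟩

/-- Corrects the solution along array `7`. -/
def updateSol : Cmd :=
  .loop 6 0 <| .seq (.mul ⟨9, 2, 2⟩ ⟨11, 2, 2⟩ ⟨7, 2, 6⟩) <|
    .sub ⟨5, 2, 6⟩ ⟨5, 2, 6⟩ ⟨9, 2, 2⟩

/-- Writes array `7` divided by the content of array `8` to array `12`. -/
def scaleRow : Cmd := .loop 6 0 <| .div ⟨12, 2, 6⟩ ⟨7, 2, 6⟩ ⟨8, 2, 2⟩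

/-- Writes the conjugate of array `7` to array `13`. -/
def conjProj : Cmd := .loop 6 0 <| .conj ⟨13, 2, 6⟩ ⟨7, 2, 6⟩

/-- Subtracts the product of arrays `12` and `13` from the projection. -/
def updateProj : Cmd :=
  .loop 6 0 <| .loop 7 0 <| .seq (.mul ⟨9, 2, 2⟩ ⟨12, 2, 6⟩ ⟨13, 2, 7⟩) <|
    .sub ⟨6, 6, 7⟩ ⟨6, 6, 7⟩ ⟨9, 2, 2⟩

/-- One round of the row projection method, for the row in register `5`. -/
def solveRound : Cmd :=
  .seq conjRow <| .seq projRow <| .seq residual <| .seq stepSize <| .seq updateSol <|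
    .seq scaleRow <| .seq conjProj updateProj

/-- Solves the linear system with matrix in array `3` and right-hand side in array `4`. -/
def solve : Cmd := .seq solveInit <| .loop 5 0 solveRound

/-- Writes the Hankel system of the first sample to arrays `3` and `4`. -/
def formHankel : Cmd :=
  .seq (.loop 5 0 <| .loop 6 0 <| .seq (.idxAdd 8 5 6) <| .add ⟨3, 5, 6⟩ ⟨2, 8, 2⟩ ⟨14, 2, 2⟩) <|
    .loop 5 0 <| .seq (.idxAdd 8 0 5) <| .sub ⟨4, 2, 5⟩ ⟨14, 2, 2⟩ ⟨2, 8, 2⟩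

/-- Finds the nodes from the first sample. -/
def findNodes : Cmd :=
  .seq formHankel <| .seq solve <| .seq (.const ⟨5, 2, 0⟩ 1) <| .query 5 0 0

/-- Writes the Fourier matrix of the nodes to array `3`. -/
def formVandermonde : Cmd :=
  .seq (.loop 6 0 <| .const ⟨3, 2, 6⟩ 1) <| .seq (.idxConst 9 1) <|
    .loop 5 0 <| .seq (.idxAdd 8 5 9) <| .loop 6 0 <| .mul ⟨3, 8, 6⟩ ⟨3, 5, 6⟩ ⟨0, 2, 6⟩

/-- Copies the current sample to the right-hand side. -/
def loadSample : Cmd := .loop 5 0 <| .add ⟨4, 2, 5⟩ ⟨2, 5, 4⟩ ⟨14, 2, 2⟩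

/-- Adds the squared moduli of the solution to array `1`. -/
def accumulate : Cmd :=
  .loop 5 0 <| .seq (.conj ⟨9, 2, 2⟩ ⟨5, 2, 5⟩) <|
    .seq (.mul ⟨9, 2, 2⟩ ⟨5, 2, 5⟩ ⟨9, 2, 2⟩) <| .add ⟨1, 2, 5⟩ ⟨1, 2, 5⟩ ⟨9, 2, 2⟩

/-- Increments array `15`. -/
def countSample : Cmd :=
  .seq (.const ⟨9, 2, 2⟩ 1) <| .add ⟨15, 2, 2⟩ ⟨15, 2, 2⟩ ⟨9, 2, 2⟩

/-- Sums the squared moduli of the weights of all samples. -/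
def findWeights : Cmd :=
  .loop 4 1 <| .seq loadSample <| .seq solve <| .seq accumulate countSample

/-- Divides the sums by the number of samples. -/
def average : Cmd := .loop 5 0 <| .div ⟨1, 2, 5⟩ ⟨1, 2, 5⟩ ⟨15, 2, 2⟩

/-- The computations following the reading of the samples. -/
def compute : Cmd := .seq findNodes <| .seq formVandermonde <| .seq findWeights average

/-- The covariance estimation algorithm as a program. -/
def program : Cmd := .seq readSamples compute

variable {O : Polynomial ℂ → List ℂ} {X : ℕ → ℕ → ℝ}

@[simp] lemma tick_mem (s : Config) : s.tick.mem = s.mem := rfl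
@[simp] lemma tick_idx (s : Config) : s.tick.idx = s.idx := rfl
@[simp] lemma setIdx_mem (s : Config) (x v : ℕ) : (s.setIdx x v).mem = s.mem := rfl
@[simp] lemma setIdx_idx (s : Config) (x v : ℕ) :
    (s.setIdx x v).idx = Function.update s.idx x v := rfl
@[simp] lemma set_idx (s : Config) (u : Loc) (v : ℂ) : (s.set u v).idx = s.idx := rfl
@[simp] lemma set_mem (s : Config) (u : Loc) (v : ℂ) (A i j : ℕ) : (s.set u v).mem A i j =
    if A = u.arr ∧ i = s.idx u.row ∧ j = s.idx u.col then v else s.mem A i j := rfl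

/-- Round `i` changes only cell `i` of the row, so on entry to that round the cell still has its
initial value. In-place updates are therefore covered. -/
lemma exec_vecLoop {p : Cmd} {x b : ℕ} {s : Config} (A a : ℕ) (f : ℕ → ℂ)
    (hp : ∀ i < s.idx b, ∀ t : Config, (∀ y, y ∉ (Cmd.loop x b p).regs → t.idx y = s.idx y) →
      t.idx x = i → (∀ B, B ∉ p.arrs → t.mem B = s.mem B) → t.mem A a i = s.mem A a i →
      ∀ r, (exec O X p t).mem A a r = if r = i then f i else t.mem A a r) (r : ℕ) :
    (exec O X (.loop x b p) s).mem A a r = if r < s.idx b then f r else s.mem A a r := by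
  refine exec_loop_mem (fun i M => ∀ r, M A a r = if r < i then f r else s.mem A a r)
    (fun r => by simp) (fun i hi t h1 h2 h3 h4 r => ?_) r
  rw [hp i hi t h1 h2 h3 (by rw [h4]; simp) r, h4]
  split_ifs <;> first | rfl | (subst_vars; rfl) | omega

lemma exec_matLoop {p : Cmd} {x y b : ℕ} {s : Config} (A : ℕ) (f : ℕ → ℕ → ℂ) (hxy : x ≠ y)
    (hbx : b ≠ x) (hby : b ≠ y) (hbp : b ∉ p.regs) (hxp : x ∉ p.regs)
    (hp : ∀ i < s.idx b, ∀ j < s.idx b, ∀ t : Config,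
      (∀ w, w ∉ (Cmd.loop x b (.loop y b p)).regs → t.idx w = s.idx w) →
      t.idx x = i → t.idx y = j → (∀ B, B ∉ p.arrs → t.mem B = s.mem B) →
      t.mem A i j = s.mem A i j →
      ∀ r c, (exec O X p t).mem A r c = if r = i ∧ c = j then f i j else t.mem A r c) (r c : ℕ) :
    (exec O X (.loop x b (.loop y b p)) s).mem A r c =
      if r < s.idx b ∧ c < s.idx b then f r c else s.mem A r c := by
  refine exec_loop_mem (fun i M => ∀ r c, M A r c =
      if r < i ∧ c < s.idx b then f r c else s.mem A r c)
    (fun r c => by simp) (fun i hi t h1 h2 h3 h4 => ?_) r c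
  have hb : t.idx b = s.idx b := h1 b (by simp [Cmd.regs, hbx, hby, hbp])
  have key := exec_loop_mem (O := O) (X := X) (x := y) (b := b) (p := p) (s := t)
    (fun j M => ∀ r c, M A r c =
      if (r < i ∧ c < s.idx b) ∨ (r = i ∧ c < j) then f r c else s.mem A r c)
    (fun r c => by rw [h4]; simp) (fun j hj t' h1' h2' h3' h4' r c => by
      rw [hb] at hj
      have h5 : ∀ w, w ∉ (Cmd.loop x b (.loop y b p)).regs → t'.idx w = s.idx w := by
        intro w hw
        rw [h1' w (fun h => hw (by simp only [Cmd.regs, List.mem_cons] at h ⊢; exact Or.inr h)),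
          h1 w hw]
      have h6 : t'.idx x = i := by rw [h1' x (by simp [Cmd.regs, hxy, hxp]), h2]
      have h7 : ∀ B, B ∉ p.arrs → t'.mem B = s.mem B := fun B hB => by rw [h3' B hB, h3 B hB]
      rw [hp i hi j hj t' h5 h6 h2' h7 (by rw [h4']; simp) r c, h4']
      split_ifs <;> first | rfl | (simp_all; done) | omega)
  intro r c
  rw [key r c, hb]
  congr 1
  apply propext
  omega

/-- Arrays `8` and `9` hold the accumulator and the current product, so the factors must be stored
elsewhere. -/
lemma exec_sumMul (s : Config) (u v : Loc) (hu : u.arr ≠ 8 ∧ u.arr ≠ 9)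
    (hv : v.arr ≠ 8 ∧ v.arr ≠ 9) :
    (exec O X (sumMul u v) s).mem 8 (s.idx 2) (s.idx 2) =
      ∑ i ∈ Finset.range (s.idx 0), (s.setIdx 7 i).get u * (s.setIdx 7 i).get v := by
  have hget : ∀ w : Loc, w.arr ≠ 8 ∧ w.arr ≠ 9 → ∀ (i : ℕ) (t : Config),
      (∀ y, y ≠ 7 → t.idx y = s.idx y) → t.idx 7 = i →
      (∀ A, A ≠ 8 ∧ A ≠ 9 → t.mem A = s.mem A) → t.get w = (s.setIdx 7 i).get w := by
    intro w hw i t h1 h2 h3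
    have h4 : t.idx = Function.update s.idx 7 i := by
      funext y
      by_cases hy : y = 7
      · subst hy; simpa using h2
      · rw [h1 y hy, Function.update_of_ne hy]
    simp [Config.get, h4, h3 w.arr hw]
  rw [sumMul, exec]
  refine exec_loop_mem (fun i M => M 8 (s.idx 2) (s.idx 2) =
    ∑ i ∈ Finset.range i, (s.setIdx 7 i).get u * (s.setIdx 7 i).get v) ?_ ?_
  · simp [exec]
  · intro i _ t h1 h2 h3 h4
    have h1' : ∀ y, y ≠ 7 → t.idx y = s.idx y := fun y hy => h1 y (by simp [Cmd.regs, hy])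
    have h3' : ∀ A, A ≠ 8 ∧ A ≠ 9 → t.mem A = s.mem A := fun A hA => by
      rw [h3 A (by simp [Cmd.arrs, hA.1, hA.2])]
      exact exec_mem _ _ (by simp [Cmd.arrs, hA.1])
    have hidx : t.idx 2 = s.idx 2 := h1' 2 (by norm_num)
    rw [Finset.sum_range_succ, ← h4, ← hget u hu i t h1' h2 h3', ← hget v hv i t h1' h2 h3']
    simp only [exec, Config.get, set_mem, set_idx, tick_idx, tick_mem, hidx]
    simp

lemma exec_conjRow (s : Config) (h2 : s.idx 2 = 0) (r : ℕ) (hr : r < s.idx 0) :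
    (exec O X conjRow s).mem 10 0 r = starRingEnd ℂ (s.mem 3 (s.idx 5) r) := by
  refine (exec_vecLoop 10 0 (fun r => starRingEnd ℂ (s.mem 3 (s.idx 5) r)) ?_ r).trans (if_pos hr)
  intro i _ t h1 ht h3 _ r
  have e2 := (h1 2 (by decide)).trans h2
  have e5 := h1 5 (by decide)
  have m3 := h3 3 (by decide)
  simp [exec, Config.get, e2, e5, m3, ht]

lemma exec_projRow (s : Config) (h2 : s.idx 2 = 0) (h14 : s.mem 14 0 0 = 0) (r : ℕ)
    (hr : r < s.idx 0) :
    (exec O X projRow s).mem 7 0 r =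
      ∑ i ∈ Finset.range (s.idx 0), s.mem 6 r i * s.mem 10 0 i := by
  refine (exec_vecLoop 7 0 (fun r => ∑ i ∈ Finset.range (s.idx 0), s.mem 6 r i * s.mem 10 0 i)
    ?_ r).trans (if_pos hr)
  intro i _ t h1 ht h3 _ r
  have e0 := h1 0 (by decide)
  have e2 := (h1 2 (by decide)).trans h2
  have m6 := h3 6 (by decide)
  have m10 := h3 10 (by decide)
  have m14 := h3 14 (by decide)
  have key := exec_sumMul (O := O) (X := X) t ⟨6, 6, 7⟩ ⟨10, 2, 7⟩ (by decide) (by decide)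
  simp only [e0, e2, Config.get, setIdx_mem, setIdx_idx, m6, m10] at key
  rw [exec]
  set t' := exec O X (sumMul ⟨6, 6, 7⟩ ⟨10, 2, 7⟩) t with ht'
  have e2' : t'.idx 2 = 0 := by rw [ht', exec_idx _ _ (by decide), e2]
  have e6' : t'.idx 6 = i := by rw [ht', exec_idx _ _ (by decide), ht]
  have m14' : t'.mem 14 = s.mem 14 := by rw [ht', exec_mem _ _ (by decide), m14]
  have m7' : t'.mem 7 = t.mem 7 := by rw [ht', exec_mem _ _ (by decide)]
  simp [exec, Config.get, e2', e6', m14', m7', h14, key, ht, e2]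

lemma exec_residual (s : Config) (h2 : s.idx 2 = 0) :
    (exec O X residual s).mem 11 0 0 =
      ∑ i ∈ Finset.range (s.idx 0), s.mem 3 (s.idx 5) i * s.mem 5 0 i - s.mem 4 0 (s.idx 5) := by
  have key := exec_sumMul (O := O) (X := X) s ⟨3, 5, 7⟩ ⟨5, 2, 7⟩ (by decide) (by decide)
  simp only [h2, Config.get, setIdx_mem, setIdx_idx] at key
  rw [residual, exec]
  set t := exec O X (sumMul ⟨3, 5, 7⟩ ⟨5, 2, 7⟩) s with ht
  have e2 : t.idx 2 = 0 := by rw [ht, exec_idx _ _ (by decide), h2]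
  have e5 : t.idx 5 = s.idx 5 := by rw [ht, exec_idx _ _ (by decide)]
  have m4 : t.mem 4 = s.mem 4 := by rw [ht, exec_mem _ _ (by decide)]
  simp [exec, Config.get, e2, e5, m4, key, h2]

lemma exec_stepSize (s : Config) (h2 : s.idx 2 = 0) :
    (exec O X stepSize s).mem 8 0 0 =
        ∑ i ∈ Finset.range (s.idx 0), s.mem 3 (s.idx 5) i * s.mem 7 0 i ∧
      (exec O X stepSize s).mem 11 0 0 = s.mem 11 0 0 /
        ∑ i ∈ Finset.range (s.idx 0), s.mem 3 (s.idx 5) i * s.mem 7 0 i := by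
  have key := exec_sumMul (O := O) (X := X) s ⟨3, 5, 7⟩ ⟨7, 2, 7⟩ (by decide) (by decide)
  simp only [h2, Config.get, setIdx_mem, setIdx_idx] at key
  rw [stepSize, exec]
  set t := exec O X (sumMul ⟨3, 5, 7⟩ ⟨7, 2, 7⟩) s with ht
  have e2 : t.idx 2 = 0 := by rw [ht, exec_idx _ _ (by decide), h2]
  have m11 : t.mem 11 = s.mem 11 := by rw [ht, exec_mem _ _ (by decide)]
  simp [exec, Config.get, e2, m11, key, h2]

lemma exec_updateSol (s : Config) (h2 : s.idx 2 = 0) (r : ℕ) (hr : r < s.idx 0) :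
    (exec O X updateSol s).mem 5 0 r = s.mem 5 0 r - s.mem 11 0 0 * s.mem 7 0 r := by
  refine (exec_vecLoop 5 0 (fun r => s.mem 5 0 r - s.mem 11 0 0 * s.mem 7 0 r) ?_ r).trans
    (if_pos hr)
  intro i _ t h1 ht h3 h4 r
  have e2 := (h1 2 (by decide)).trans h2
  have m7 := h3 7 (by decide)
  have m11 := h3 11 (by decide)
  simp [exec, Config.get, e2, m7, m11, ht, h4]

lemma exec_scaleRow (s : Config) (h2 : s.idx 2 = 0) (r : ℕ) (hr : r < s.idx 0) :
    (exec O X scaleRow s).mem 12 0 r = s.mem 7 0 r / s.mem 8 0 0 := by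
  refine (exec_vecLoop 12 0 (fun r => s.mem 7 0 r / s.mem 8 0 0) ?_ r).trans (if_pos hr)
  intro i _ t h1 ht h3 _ r
  have e2 := (h1 2 (by decide)).trans h2
  have m7 := h3 7 (by decide)
  have m8 := h3 8 (by decide)
  simp [exec, Config.get, e2, m7, m8, ht]

lemma exec_conjProj (s : Config) (h2 : s.idx 2 = 0) (r : ℕ) (hr : r < s.idx 0) :
    (exec O X conjProj s).mem 13 0 r = starRingEnd ℂ (s.mem 7 0 r) := by
  refine (exec_vecLoop 13 0 (fun r => starRingEnd ℂ (s.mem 7 0 r)) ?_ r).trans (if_pos hr)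
  intro i _ t h1 ht h3 _ r
  have e2 := (h1 2 (by decide)).trans h2
  have m7 := h3 7 (by decide)
  simp [exec, Config.get, e2, m7, ht]

lemma exec_updateProj (s : Config) (h2 : s.idx 2 = 0) (r c : ℕ) (hr : r < s.idx 0)
    (hc : c < s.idx 0) :
    (exec O X updateProj s).mem 6 r c = s.mem 6 r c - s.mem 12 0 r * s.mem 13 0 c := by
  refine (exec_matLoop 6 (fun r c => s.mem 6 r c - s.mem 12 0 r * s.mem 13 0 c) (by decide)
    (by decide) (by decide) (by decide) (by decide) ?_ r c).trans (if_pos ⟨hr, hc⟩)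
  intro i _ j _ t h1 hti htj h3 h4 r c
  have e2 := (h1 2 (by decide)).trans h2
  have m12 := h3 12 (by decide)
  have m13 := h3 13 (by decide)
  simp [exec, Config.get, e2, m12, m13, hti, htj, h4]

/-- The leading `k × k` block of an array. -/
def matOf (k : ℕ) (f : ℕ → ℕ → ℂ) : Matrix (Fin k) (Fin k) ℂ := Matrix.of fun i j => f i j

/-- The first `k` entries of a row of an array. -/
def vecOf (k : ℕ) (f : ℕ → ℂ) : Fin k → ℂ := fun i => f i

lemma exec_solveRound {k : ℕ} (s : Config) (hk : s.idx 0 = k) (h2 : s.idx 2 = 0)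
    (h14 : s.mem 14 0 0 = 0) {i : Fin k} (hi : s.idx 5 = i) {A : Matrix (Fin k) (Fin k) ℂ}
    (hA : A = matOf k (s.mem 3)) (hdet : A.det ≠ 0) {b : Fin k → ℂ}
    (hb : b = vecOf k (s.mem 4 0)) {H : Matrix (Fin k) (Fin k) ℂ} (hH : H = matOf k (s.mem 6))
    {c : Fin k → ℂ} (hc : c = vecOf k (s.mem 5 0)) (h : IsPartialSolution A b i H c) :
    IsPartialSolution A b (i + 1) (matOf k ((exec O X solveRound s).mem 6))
      (vecOf k ((exec O X solveRound s).mem 5 0)) := by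
  obtain ⟨v, hv⟩ : ∃ v : Fin k → ℂ, v = H *ᵥ star (A i) := ⟨_, rfl⟩
  obtain ⟨s₁, h₁⟩ : ∃ t, t = exec O X conjRow s := ⟨_, rfl⟩
  obtain ⟨s₂, h₂⟩ : ∃ t, t = exec O X projRow s₁ := ⟨_, rfl⟩
  obtain ⟨s₃, h₃⟩ : ∃ t, t = exec O X residual s₂ := ⟨_, rfl⟩
  obtain ⟨s₄, h₄⟩ : ∃ t, t = exec O X stepSize s₃ := ⟨_, rfl⟩
  obtain ⟨s₅, h₅⟩ : ∃ t, t = exec O X updateSol s₄ := ⟨_, rfl⟩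
  obtain ⟨s₆, h₆⟩ : ∃ t, t = exec O X scaleRow s₅ := ⟨_, rfl⟩
  obtain ⟨s₇, h₇⟩ : ∃ t, t = exec O X conjProj s₆ := ⟨_, rfl⟩
  obtain ⟨s₈, h₈⟩ : ∃ t, t = exec O X updateProj s₇ := ⟨_, rfl⟩
  have hs : exec O X solveRound s = s₈ := by
    rw [h₈, h₇, h₆, h₅, h₄, h₃, h₂, h₁]
    simp only [solveRound, exec]
  have f₁ : ∀ x ∈ [0, 2, 5], s₁.idx x = s.idx x := fun x hx => by
    rw [h₁]
    exact exec_idx _ _ (by fin_cases hx <;> decide)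
  have f₂ : ∀ x ∈ [0, 2, 5], s₂.idx x = s.idx x := fun x hx => by
    rw [h₂, ← f₁ x hx]
    exact exec_idx _ _ (by fin_cases hx <;> decide)
  have f₃ : ∀ x ∈ [0, 2, 5], s₃.idx x = s.idx x := fun x hx => by
    rw [h₃, ← f₂ x hx]
    exact exec_idx _ _ (by fin_cases hx <;> decide)
  have f₄ : ∀ x ∈ [0, 2, 5], s₄.idx x = s.idx x := fun x hx => by
    rw [h₄, ← f₃ x hx]
    exact exec_idx _ _ (by fin_cases hx <;> decide)
  have f₅ : ∀ x ∈ [0, 2, 5], s₅.idx x = s.idx x := fun x hx => by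
    rw [h₅, ← f₄ x hx]
    exact exec_idx _ _ (by fin_cases hx <;> decide)
  have f₆ : ∀ x ∈ [0, 2, 5], s₆.idx x = s.idx x := fun x hx => by
    rw [h₆, ← f₅ x hx]
    exact exec_idx _ _ (by fin_cases hx <;> decide)
  have f₇ : ∀ x ∈ [0, 2, 5], s₇.idx x = s.idx x := fun x hx => by
    rw [h₇, ← f₆ x hx]
    exact exec_idx _ _ (by fin_cases hx <;> decide)
  have hv' : ∀ r : Fin k, s₂.mem 7 0 r = v r := by
    intro r
    have m14 : s₁.mem 14 = s.mem 14 := by rw [h₁, exec_mem _ _ (by decide)]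
    have m6 : s₁.mem 6 = s.mem 6 := by rw [h₁, exec_mem _ _ (by decide)]
    rw [h₂, exec_projRow s₁ ((f₁ 2 (by decide)).trans h2) (by rw [m14, h14]) r
      (by rw [f₁ 0 (by decide), hk]; exact r.2), f₁ 0 (by decide), hk, Finset.sum_range, hv]
    refine Finset.sum_congr rfl fun t _ => ?_
    rw [m6, h₁, exec_conjRow s h2 t (by rw [hk]; exact t.2), hi, hH, hA]
    rfl
  have m3 : s₂.mem 3 = s.mem 3 := by rw [h₂, exec_mem _ _ (by decide), h₁, exec_mem _ _ (by decide)]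
  have m4 : s₂.mem 4 = s.mem 4 := by rw [h₂, exec_mem _ _ (by decide), h₁, exec_mem _ _ (by decide)]
  have m5 : s₂.mem 5 = s.mem 5 := by rw [h₂, exec_mem _ _ (by decide), h₁, exec_mem _ _ (by decide)]
  have hρ : s₃.mem 11 0 0 = A i ⬝ᵥ c - b i := by
    rw [h₃, exec_residual s₂ ((f₂ 2 (by decide)).trans h2), f₂ 0 (by decide), f₂ 5 (by decide),
      m3, m4, m5, hi, hk, Finset.sum_range, hA, hb, hc]
    rfl
  have m3' : s₃.mem 3 = s.mem 3 := by rw [h₃, exec_mem _ _ (by decide), h₂,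
  exec_mem _ _ (by decide), h₁, exec_mem _ _ (by decide)]
  have m7' : s₃.mem 7 = s₂.mem 7 := by rw [h₃, exec_mem _ _ (by decide)]
  have hα : ∑ t ∈ Finset.range (s₃.idx 0), s₃.mem 3 (s₃.idx 5) t * s₃.mem 7 0 t = A i ⬝ᵥ v := by
    rw [f₃ 0 (by decide), f₃ 5 (by decide), m3', m7', hi, hk, Finset.sum_range]
    refine Finset.sum_congr rfl fun t _ => ?_
    rw [hv', hA]
    rfl
  obtain ⟨h₄α, h₄ρ⟩ := exec_stepSize (O := O) (X := X) s₃ ((f₃ 2 (by decide)).trans h2)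
  rw [hα, ← h₄] at h₄α
  rw [hα, hρ, ← h₄] at h₄ρ
  have m5' : s₄.mem 5 = s.mem 5 := by rw [h₄, exec_mem _ _ (by decide), h₃,
  exec_mem _ _ (by decide), h₂, exec_mem _ _ (by decide), h₁, exec_mem _ _ (by decide)]
  have m7₄ : s₄.mem 7 = s₂.mem 7 := by rw [h₄, exec_mem _ _ (by decide), h₃,
  exec_mem _ _ (by decide)]
  have hsol : vecOf k (s₈.mem 5 0) = c - ((A i ⬝ᵥ c - b i) / (A i ⬝ᵥ v)) • v := by
    have m : s₈.mem 5 = s₅.mem 5 := by rw [h₈, exec_mem _ _ (by decide), h₇,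
    exec_mem _ _ (by decide), h₆, exec_mem _ _ (by decide)]
    ext r
    have := exec_updateSol (O := O) (X := X) s₄ ((f₄ 2 (by decide)).trans h2) r
      (by rw [f₄ 0 (by decide), hk]; exact r.2)
    rw [vecOf, m, h₅, this, m5', h₄ρ, m7₄, hv', Pi.sub_apply, Pi.smul_apply, hc]
    rfl
  have m7₆ : s₆.mem 7 = s₂.mem 7 := by rw [h₆, exec_mem _ _ (by decide), h₅,
  exec_mem _ _ (by decide), h₄, exec_mem _ _ (by decide), h₃, exec_mem _ _ (by decide)]
  have m8₅ : s₅.mem 8 = s₄.mem 8 := by rw [h₅, exec_mem _ _ (by decide)]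
  have m7₅ : s₅.mem 7 = s₂.mem 7 := by rw [h₅, exec_mem _ _ (by decide), h₄,
  exec_mem _ _ (by decide), h₃, exec_mem _ _ (by decide)]
  have h12 : ∀ r : Fin k, s₇.mem 12 0 r = v r / (A i ⬝ᵥ v) := by
    intro r
    have m : s₇.mem 12 = s₆.mem 12 := by rw [h₇, exec_mem _ _ (by decide)]
    rw [m, h₆, exec_scaleRow s₅ ((f₅ 2 (by decide)).trans h2) r
      (by rw [f₅ 0 (by decide), hk]; exact r.2), m7₅, m8₅, h₄α, hv']
  have h13 : ∀ r : Fin k, s₇.mem 13 0 r = star (v r) := by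
    intro r
    rw [h₇, exec_conjProj s₆ ((f₆ 2 (by decide)).trans h2) r
      (by rw [f₆ 0 (by decide), hk]; exact r.2), m7₆, hv']
    rfl
  have m6 : s₇.mem 6 = s.mem 6 := by
    rw [h₇, exec_mem _ _ (by decide), h₆, exec_mem _ _ (by decide), h₅, exec_mem _ _ (by decide),
      h₄, exec_mem _ _ (by decide), h₃, exec_mem _ _ (by decide), h₂, exec_mem _ _ (by decide),
      h₁, exec_mem _ _ (by decide)]
  have hproj : matOf k (s₈.mem 6) = H - (A i ⬝ᵥ v)⁻¹ • vecMulVec v (star v) := by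
    ext r t
    have := exec_updateProj (O := O) (X := X) s₇ ((f₇ 2 (by decide)).trans h2) r t
      (by rw [f₇ 0 (by decide), hk]; exact r.2) (by rw [f₇ 0 (by decide), hk]; exact t.2)
    rw [matOf, Matrix.of_apply, h₈, this, m6, h12, h13, Matrix.sub_apply, Matrix.smul_apply,
      Matrix.vecMulVec_apply, smul_eq_mul, ← mul_assoc, div_eq_inv_mul, hH]
    rfl
  rw [hs, hproj, hsol]
  exact h.succ hdet hv rfl

lemma exec_solveInit (s : Config) (h2 : s.idx 2 = 0) :
    matOf (s.idx 0) ((exec O X solveInit s).mem 6) = 1 ∧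
      vecOf (s.idx 0) ((exec O X solveInit s).mem 5 0) = 0 := by
  rw [solveInit, exec, exec]
  set s₁ := exec O X (.loop 6 0 <| .const ⟨5, 2, 6⟩ 0) s with h₁
  set s₂ := exec O X (.loop 6 0 <| .loop 7 0 <| .const ⟨6, 6, 7⟩ 0) s₁ with h₂
  set s₃ := exec O X (.loop 6 0 <| .const ⟨6, 6, 6⟩ 1) s₂ with h₃
  have e0 : s₁.idx 0 = s.idx 0 := exec_idx _ _ (by decide)
  have e0' : s₂.idx 0 = s.idx 0 := (exec_idx _ _ (by decide)).trans e0
  have hone := exec_loop_mem (O := O) (X := X) (x := 6) (b := 0) (p := .const ⟨6, 6, 6⟩ 1) (s := s₂)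
    (fun i M => ∀ r c, M 6 r c = if r = c ∧ r < i then 1 else s₂.mem 6 r c) (by simp)
    (fun i _ t _ ht _ h4 r c => by
      simp only [exec, set_mem, tick_idx, ht, tick_mem, h4]
      by_cases hrc : r = c
      · subst hrc
        by_cases hri : r = i
        · simp [hri]
        · have : r < i + 1 ↔ r < i := by omega
          simp [hri, this]
      · have : ¬ (r = i ∧ c = i) := by rintro ⟨rfl, rfl⟩; exact hrc rfl
        simp [hrc, this])
  have hzero := exec_matLoop (O := O) (X := X) (x := 6) (y := 7) (b := 0)
    (p := .const ⟨6, 6, 7⟩ 0) (s := s₁) 6 (fun _ _ => 0) (by decide)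
    (by decide) (by decide) (by decide) (by decide)
    (fun i _ j _ t _ hti htj _ _ r c => by simp [exec, hti, htj])
  have hvec := exec_vecLoop (O := O) (X := X) (x := 6) (b := 0) (p := .const ⟨5, 2, 6⟩ 0) (s := s)
    5 0 (fun _ => 0) (fun i _ t h1 ht _ _ r => by
      have e2 := (h1 2 (by decide)).trans h2
      simp [exec, ht, e2])
  constructor
  · ext r c
    have h5 : s₂.mem 6 r c = 0 := by
      rw [h₂, hzero, if_pos]
      rw [e0]
      exact ⟨r.2, c.2⟩
    rw [matOf, Matrix.of_apply, h₃, hone, h5, e0', Matrix.one_apply]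
    simp [Fin.ext_iff]
  · ext r
    have m5 : s₃.mem 5 = s₁.mem 5 := (exec_mem _ _ (by decide)).trans (exec_mem _ _ (by decide))
    rw [vecOf, m5, h₁, hvec, if_pos r.2]
    rfl

/-- `IsPartialSolution` is the loop invariant; after `k` rounds every equation holds. A nonzero
determinant keeps all divisors nonzero. -/
lemma exec_solve (s : Config) (h2 : s.idx 2 = 0) (h14 : s.mem 14 0 0 = 0)
    (hA : (matOf (s.idx 0) (s.mem 3)).det ≠ 0) :
    matOf (s.idx 0) (s.mem 3) *ᵥ vecOf (s.idx 0) ((exec O X solve s).mem 5 0) =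
      vecOf (s.idx 0) (s.mem 4 0) := by
  rw [solve, exec]
  obtain ⟨hH, hc⟩ := exec_solveInit (O := O) (X := X) s h2
  set s₁ := exec O X solveInit s with h₁
  have e0 : s₁.idx 0 = s.idx 0 := exec_idx _ _ (by decide)
  have e2 : s₁.idx 2 = 0 := (exec_idx _ _ (by decide)).trans h2
  have m3 : s₁.mem 3 = s.mem 3 := exec_mem _ _ (by decide)
  have m4 : s₁.mem 4 = s.mem 4 := exec_mem _ _ (by decide)
  have m14 : s₁.mem 14 = s.mem 14 := exec_mem _ _ (by decide)
  have key := exec_loop_mem (O := O) (X := X) (x := 5) (b := 0) (p := solveRound) (s := s₁)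
    (fun i M => IsPartialSolution (matOf (s.idx 0) (s.mem 3)) (vecOf (s.idx 0) (s.mem 4 0)) i
      (matOf (s.idx 0) (M 6)) (vecOf (s.idx 0) (M 5 0)))
    (by simp only [hH, hc]; exact isPartialSolution_zero)
    (fun i hi t h1 ht h3 h4 => by
      have t0 : t.idx 0 = s.idx 0 := (h1 0 (by decide)).trans e0
      have t2 : t.idx 2 = 0 := (h1 2 (by decide)).trans e2
      have t3 : t.mem 3 = s.mem 3 := (h3 3 (by decide)).trans m3
      have t4 : t.mem 4 = s.mem 4 := (h3 4 (by decide)).trans m4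
      have t14 : t.mem 14 0 0 = 0 := by rw [h3 14 (by decide), m14, h14]
      exact exec_solveRound t t0 t2 t14 (i := ⟨i, by rw [← e0]; exact hi⟩) ht (by rw [t3]) hA
        (by rw [t4]) rfl rfl h4)
  rw [e0] at key
  exact key.mulVec_eq

end Program

/-! ### What the remaining routines compute and read. -/

section Correctness

variable {O : Polynomial ℂ → List ℂ} {X : ℕ → ℕ → ℝ}

/-- Loops can only be bounded by `k` or `n` here, so each inner round reads the two entries `i` and
`k + i`, and `k` rounds cover all `2 k`. -/
lemma exec_readSamples_mem (s : Config) :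
    ∀ j < s.idx 1, ∀ i < s.idx 0, (exec O X readSamples s).mem 2 i j = X i j ∧
      (exec O X readSamples s).mem 2 (s.idx 0 + i) j = X (s.idx 0 + i) j := by
  have hstep : ∀ (t : Config) (a b : ℕ), (exec O X (.seq (.read ⟨2, 5, 4⟩ 5 4) <|
      .seq (.idxAdd 8 0 5) <| .read ⟨2, 8, 4⟩ 8 4) t).mem 2 a b =
      if (a = t.idx 5 ∨ a = t.idx 0 + t.idx 5) ∧ b = t.idx 4 then (X a b : ℂ)
      else t.mem 2 a b := by
    intro t a b
    simp only [exec, Config.set, Config.tick, Config.setIdx]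
    simp
    split_ifs <;> first | rfl | simp_all
  refine exec_loop_mem (fun j M => ∀ b < j, ∀ a < s.idx 0,
    M 2 a b = X a b ∧ M 2 (s.idx 0 + a) b = X (s.idx 0 + a) b) (by simp) ?_
  intro j _ t h1 ht _ h4
  have t0 : t.idx 0 = s.idx 0 := h1 0 (by decide)
  have key := exec_loop_mem (O := O) (X := X) (x := 5) (b := 0) (s := t)
    (p := .seq (.read ⟨2, 5, 4⟩ 5 4) <| .seq (.idxAdd 8 0 5) <| .read ⟨2, 8, 4⟩ 8 4)
    (fun i M => (∀ b < j, ∀ a < s.idx 0,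
      M 2 a b = X a b ∧ M 2 (s.idx 0 + a) b = X (s.idx 0 + a) b) ∧
      ∀ a < i, M 2 a j = X a j ∧ M 2 (s.idx 0 + a) j = X (s.idx 0 + a) j)
    ⟨h4, by simp⟩ (fun i _ t' h1' ht' _ h4' => by
      have e0 : t'.idx 0 = s.idx 0 := (h1' 0 (by decide)).trans t0
      have e4 : t'.idx 4 = j := (h1' 4 (by decide)).trans ht
      simp only [hstep, e0, e4, ht']
      refine ⟨fun b hb a ha => ?_, fun a ha => ?_⟩
      · rw [if_neg (by omega), if_neg (by omega)]
        exact h4'.1 b hb a ha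
      · rcases Nat.lt_succ_iff_lt_or_eq.1 ha with ha | rfl
        · constructor
          · split_ifs
            · rfl
            · exact (h4'.2 a ha).1
          · split_ifs
            · rfl
            · exact (h4'.2 a ha).2
        · simp)
  intro b hb a ha
  rcases Nat.lt_succ_iff_lt_or_eq.1 hb with hb | rfl
  · exact key.1 b hb a ha
  · exact key.2 a (by rw [t0]; exact ha)

/-- The two parts together express single reading: a list of length `2 k n` whose members are
exactly `2 k n` pairs has no repetition. -/
lemma exec_readSamples_reads (s : Config) (hs : s.reads = []) :
    (exec O X readSamples s).reads.length = 2 * s.idx 0 * s.idx 1 ∧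
      ∀ a b, (a, b) ∈ (exec O X readSamples s).reads ↔ a < 2 * s.idx 0 ∧ b < s.idx 1 := by
  set k := s.idx 0 with hk
  have key := exec_loop_induction (O := O) (X := X) (x := 4) (b := 1) (s := s)
    (p := .loop 5 0 <| .seq (.read ⟨2, 5, 4⟩ 5 4) <| .seq (.idxAdd 8 0 5) <|
      .read ⟨2, 8, 4⟩ 8 4)
    (fun j t => t.idx 0 = k ∧ t.reads.length = 2 * k * j ∧
      ∀ a b, (a, b) ∈ t.reads ↔ a < 2 * k ∧ b < j)
    ⟨rfl, by simp [Config.tick, hs], by simp [Config.tick, hs]⟩ (fun j _ t ht => by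
      obtain ⟨ht0, htl, htm⟩ := ht
      have inner := exec_loop_induction (O := O) (X := X) (x := 5) (b := 0)
        (s := t.tick.setIdx 4 j)
        (p := .seq (.read ⟨2, 5, 4⟩ 5 4) <| .seq (.idxAdd 8 0 5) <| .read ⟨2, 8, 4⟩ 8 4)
        (fun i t' => t'.idx 0 = k ∧ t'.idx 4 = j ∧ t'.reads.length = 2 * k * j + 2 * i ∧
          ∀ a b, (a, b) ∈ t'.reads ↔
            a < 2 * k ∧ b < j ∨ (a < i ∨ k ≤ a ∧ a < k + i) ∧ b = j)
        ⟨by simp [ht0], by simp, by simp [Config.tick, Config.setIdx, htl], fun a b => by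
          have : ((t.tick.setIdx 4 j).tick).reads = t.reads := rfl
          rw [this, htm]
          omega⟩ (fun i _ t' ht' => by
          obtain ⟨h0, h4, hl, hm⟩ := ht'
          have hr : (exec O X (.seq (.read ⟨2, 5, 4⟩ 5 4) <| .seq (.idxAdd 8 0 5) <|
              .read ⟨2, 8, 4⟩ 8 4) (t'.tick.setIdx 5 i)).reads =
              (k + i, j) :: (i, j) :: t'.reads := by
            simp [exec, Config.set, Config.tick, Config.setIdx, h0, h4]
          refine ⟨?_, ?_, ?_, fun a b => ?_⟩
          · rw [exec_idx _ _ (by decide)]; simp [h0]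
          · rw [exec_idx _ _ (by decide)]; simp [h4]
          · rw [hr]; simp [hl]; ring
          · rw [hr, List.mem_cons, List.mem_cons, hm, Prod.mk.injEq, Prod.mk.injEq]
            omega)
      have hb : (t.tick.setIdx 4 j).idx 0 = k := by simp [ht0]
      rw [hb] at inner
      obtain ⟨h0, _, hl, hm⟩ := inner
      refine ⟨h0, by rw [hl]; ring, fun a b => ?_⟩
      rw [hm]
      omega)
  exact key.2

/-- The zero cell of array `14` turns addition into copying and subtraction into negation. -/
lemma exec_formHankel (s : Config) (h2 : s.idx 2 = 0) (h14 : s.mem 14 0 0 = 0) :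
    (∀ r < s.idx 0, ∀ c < s.idx 0, (exec O X formHankel s).mem 3 r c = s.mem 2 (r + c) 0) ∧
      ∀ r < s.idx 0, (exec O X formHankel s).mem 4 0 r = - s.mem 2 (s.idx 0 + r) 0 := by
  rw [formHankel, exec]
  obtain ⟨s₁, h₁⟩ : ∃ t, t = exec O X (.loop 5 0 <| .loop 6 0 <| .seq (.idxAdd 8 5 6) <|
    .add ⟨3, 5, 6⟩ ⟨2, 8, 2⟩ ⟨14, 2, 2⟩) s := ⟨_, rfl⟩
  have e0 : s₁.idx 0 = s.idx 0 := by rw [h₁, exec_idx _ _ (by decide)]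
  have e2 : s₁.idx 2 = 0 := by rw [h₁, exec_idx _ _ (by decide), h2]
  have m2 : s₁.mem 2 = s.mem 2 := by rw [h₁, exec_mem _ _ (by decide)]
  have m14 : s₁.mem 14 = s.mem 14 := by rw [h₁, exec_mem _ _ (by decide)]
  rw [← h₁]
  constructor
  · intro r hr c hc
    rw [exec_mem _ _ (by decide), h₁]
    refine (exec_matLoop 3 (fun r c => s.mem 2 (r + c) 0) (by decide) (by decide) (by decide)
      (by decide) (by decide) ?_ r c).trans (if_pos ⟨hr, hc⟩)
    intro i _ j _ t h1 hti htj h3 _ r c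
    have t2 := (h1 2 (by decide)).trans h2
    have m2 := h3 2 (by decide)
    have m14 := h3 14 (by decide)
    simp [exec, Config.get, t2, m2, m14, hti, htj, h14]
  · intro r hr
    refine (exec_vecLoop 4 0 (fun r => - s.mem 2 (s.idx 0 + r) 0) ?_ r).trans
      (if_pos (by rw [e0]; exact hr))
    intro i _ t h1 ht h3 _ r
    have t0 := (h1 0 (by decide)).trans e0
    have t2 := (h1 2 (by decide)).trans e2
    have m2' := (h3 2 (by decide)).trans m2
    have m14' := (h3 14 (by decide)).trans m14
    simp [exec, Config.get, t0, t2, m2', m14', ht, h14]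

lemma exec_findNodes {k : ℕ} (s : Config) (hk : s.idx 0 = k) (h2 : s.idx 2 = 0)
    (h14 : s.mem 14 0 0 = 0) {w : Fin (2 * k) → ℝ}
    (hw : ∀ i : Fin (2 * k), s.mem 2 i 0 = w i) (hdet : (hankel w).det ≠ 0) :
    ∃ c, hankel w *ᵥ c = -shifted w ∧
      ∀ j, (exec O X findNodes s).mem 0 0 j = (O (pronyPoly c)).getD j 0 := by
  subst hk
  rw [findNodes, exec, exec]
  obtain ⟨hM, hv⟩ := exec_formHankel (O := O) (X := X) s h2 h14
  obtain ⟨s₁, h₁⟩ : ∃ t, t = exec O X formHankel s := ⟨_, rfl⟩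
  rw [← h₁] at hM hv ⊢
  have e0 : s₁.idx 0 = s.idx 0 := by rw [h₁, exec_idx _ _ (by decide)]
  have e2 : s₁.idx 2 = 0 := by rw [h₁, exec_idx _ _ (by decide), h2]
  have m14 : s₁.mem 14 = s.mem 14 := by rw [h₁, exec_mem _ _ (by decide)]
  have hMat : matOf (s.idx 0) (s₁.mem 3) = hankel w := by
    ext r c
    rw [matOf, Matrix.of_apply, hM r r.2 c c.2, hankel, Matrix.of_apply, ← hw]
  have hVec : vecOf (s.idx 0) (s₁.mem 4 0) = - shifted w := by
    ext r
    rw [vecOf, hv r r.2, Pi.neg_apply, shifted, ← hw]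
  have hsol := exec_solve (O := O) (X := X) s₁ e2 (by rw [m14, h14])
    (by rw [e0, hMat]; exact hdet)
  rw [e0, hMat, hVec] at hsol
  refine ⟨_, hsol, fun j => ?_⟩
  obtain ⟨s₂, h₂⟩ : ∃ t, t = exec O X solve s₁ := ⟨_, rfl⟩
  rw [← h₂]
  have e0' : s₂.idx 0 = s.idx 0 := by rw [h₂, exec_idx _ _ (by decide), e0]
  have e2' : s₂.idx 2 = 0 := by rw [h₂, exec_idx _ _ (by decide), e2]
  -- Writing `1` at position `k`, just behind the solution, supplies the leading coefficient of the
  -- monic polynomial.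
  have hpoly : (exec O X (.const ⟨5, 2, 0⟩ 1) s₂).polyAt 5 0 =
      pronyPoly (vecOf (s.idx 0) (s₂.mem 5 0)) := by
    have hidx : (exec O X (.const ⟨5, 2, 0⟩ 1) s₂).idx 0 = s.idx 0 := e0'
    rw [Config.polyAt, hidx, Finset.sum_range_succ, Finset.sum_range, pronyPoly, add_comm]
    congr 1
    · simp [exec, e0', e2']
    · refine Finset.sum_congr rfl fun i _ => ?_
      have : (i : ℕ) ≠ s.idx 0 := i.2.ne
      simp [exec, e0', this, vecOf]
  have hq : ∀ t : Config, exec O X (.seq (.const ⟨5, 2, 0⟩ 1) (.query 5 0 0)) t =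
      exec O X (.query 5 0 0) (exec O X (.const ⟨5, 2, 0⟩ 1) t) := fun _ => rfl
  rw [hq, ← hpoly]
  simp [exec, Config.setRow]

lemma exec_formVandermonde (s : Config) (h2 : s.idx 2 = 0) :
    matOf (s.idx 0) ((exec O X formVandermonde s).mem 3) =
      fourierMatrix (s.idx 0) (vecOf (s.idx 0) (s.mem 0 0)) := by
  rw [formVandermonde, exec, exec]
  have hone := exec_vecLoop (O := O) (X := X) (x := 6) (b := 0) (p := .const ⟨3, 2, 6⟩ 1) (s := s)
    3 0 (fun _ => 1) (fun i _ t h1 ht _ _ r => by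
      have t2 := (h1 2 (by decide)).trans h2
      simp [exec, ht, t2])
  obtain ⟨s₁, h₁⟩ : ∃ t, t = exec O X (.loop 6 0 <| .const ⟨3, 2, 6⟩ 1) s := ⟨_, rfl⟩
  rw [← h₁] at hone ⊢
  obtain ⟨s₂, h₂⟩ : ∃ t, t = exec O X (.idxConst 9 1) s₁ := ⟨_, rfl⟩
  rw [← h₂]
  have e0 : s₂.idx 0 = s.idx 0 := by
    rw [h₂, exec_idx _ _ (by decide), h₁, exec_idx _ _ (by decide)]
  have e2 : s₂.idx 2 = 0 := by
    rw [h₂, exec_idx _ _ (by decide), h₁, exec_idx _ _ (by decide), h2]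
  have e9 : s₂.idx 9 = 1 := by rw [h₂]; simp [exec]
  have m0 : s₂.mem 0 = s.mem 0 := by
    rw [h₂, exec_mem _ _ (by decide), h₁, exec_mem _ _ (by decide)]
  have m3 : s₂.mem 3 = s₁.mem 3 := by rw [h₂, exec_mem _ _ (by decide)]
  -- Round `i` multiplies row `i` by the nodes to get row `i + 1`. Row `0` is already present,
  -- whence `a ≤ i`; the extra row `k` lies outside the block that is used.
  have key := exec_loop_mem (O := O) (X := X) (x := 5) (b := 0) (s := s₂)
    (p := .seq (.idxAdd 8 5 9) <| .loop 6 0 <| .mul ⟨3, 8, 6⟩ ⟨3, 5, 6⟩ ⟨0, 2, 6⟩)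
    (fun i M => ∀ a ≤ i, ∀ l < s.idx 0, M 3 a l = s.mem 0 0 l ^ a)
    (fun a ha l hl => by
      obtain rfl : a = 0 := Nat.le_zero.1 ha
      rw [m3, hone, if_pos hl, pow_zero])
    (fun i _ t h1 ht h3 h4 a ha l hl => by
      rw [exec]
      obtain ⟨t', ht'⟩ : ∃ u, u = exec O X (.idxAdd 8 5 9) t := ⟨_, rfl⟩
      rw [← ht']
      have t0 : t'.idx 0 = s.idx 0 := by rw [ht', exec_idx _ _ (by decide), h1 0 (by decide), e0]
      have t2 : t'.idx 2 = 0 := by rw [ht', exec_idx _ _ (by decide), h1 2 (by decide), e2]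
      have t5 : t'.idx 5 = i := by rw [ht', exec_idx _ _ (by decide), ht]
      have t9 : t.idx 9 = 1 := by rw [h1 9 (by decide), e9]
      have t8 : t'.idx 8 = i + 1 := by rw [ht']; simp [exec, ht, t9]
      have m3' : t'.mem 3 = t.mem 3 := by rw [ht', exec_mem _ _ (by decide)]
      have m0' : t'.mem 0 = s.mem 0 := by
        rw [ht', exec_mem _ _ (by decide), h3 0 (by decide), m0]
      have inner := exec_loop_mem (O := O) (X := X) (x := 6) (b := 0) (s := t')
        (p := .mul ⟨3, 8, 6⟩ ⟨3, 5, 6⟩ ⟨0, 2, 6⟩)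
        (fun c M => ∀ a l, M 3 a l =
          if a = i + 1 ∧ l < c then t.mem 3 i l * s.mem 0 0 l else t.mem 3 a l)
        (fun a l => by simp [m3']) (fun c _ u hu1 hu hu3 hu4 a l => by
          have u2 := (hu1 2 (by decide)).trans t2
          have u5 := (hu1 5 (by decide)).trans t5
          have u8 := (hu1 8 (by decide)).trans t8
          have um0 := (hu3 0 (by decide)).trans m0'
          have hui : u.mem 3 i c = t.mem 3 i c := by rw [hu4, if_neg (by omega)]
          simp only [exec, Config.get, set_mem, tick_mem, tick_idx, u2, u5, u8, um0, hu, hui]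
          rw [hu4]
          simp only [true_and]
          split_ifs <;> first | rfl | (simp_all; done) | omega)
      rw [inner a l, t0]
      split_ifs with hif
      · rw [h4 i le_rfl l hl, hif.1, pow_succ]
      · exact h4 a (by omega) l hl)
  ext a l
  rw [matOf, Matrix.of_apply, key a (by rw [e0]; exact a.2.le) l l.2]
  rfl

/-- Array `15` counts the samples because the machine cannot convert an index register into a number
for the final division. -/
lemma exec_findWeights {k : ℕ} (s : Config) (hk : s.idx 0 = k) (h2 : s.idx 2 = 0)
    (h14 : s.mem 14 0 0 = 0) (h1 : ∀ l, s.mem 1 0 l = 0) (h15 : s.mem 15 0 0 = 0)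
    (hdet : (matOf k (s.mem 3)).det ≠ 0) {y : ℕ → Fin k → ℂ}
    (hy : ∀ j < s.idx 1, ∀ c, matOf k (s.mem 3) *ᵥ c = vecOf k (fun i => s.mem 2 i j) →
      c = y j) :
    (exec O X findWeights s).mem 15 0 0 = s.idx 1 ∧
      ∀ l : Fin k, (exec O X findWeights s).mem 1 0 l =
        ∑ j ∈ Finset.range (s.idx 1), y j l * starRingEnd ℂ (y j l) := by
  refine exec_loop_mem (fun j M => M 15 0 0 = j ∧ ∀ l : Fin k, M 1 0 l =
    ∑ i ∈ Finset.range j, y i l * starRingEnd ℂ (y i l)) (by simp [h15, h1]) ?_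
  intro j hj t ht1 ht ht3 ht4
  simp only [exec]
  have t0 : t.idx 0 = k := (ht1 0 (by decide)).trans hk
  have t2 : t.idx 2 = 0 := (ht1 2 (by decide)).trans h2
  have tm2 : t.mem 2 = s.mem 2 := ht3 2 (by decide)
  have tm3 : t.mem 3 = s.mem 3 := ht3 3 (by decide)
  have tm14 : t.mem 14 0 0 = 0 := by rw [ht3 14 (by decide), h14]
  have hload := exec_vecLoop (O := O) (X := X) (x := 5) (b := 0) (s := t)
    (p := .add ⟨4, 2, 5⟩ ⟨2, 5, 4⟩ ⟨14, 2, 2⟩) 4 0 (fun i => s.mem 2 i j)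
    (fun i _ u hu1 hu hu3 _ r => by
      have u2 := (hu1 2 (by decide)).trans t2
      have u4 := (hu1 4 (by decide)).trans ht
      have um2 := (hu3 2 (by decide)).trans tm2
      have um14 := hu3 14 (by decide)
      simp [exec, Config.get, u2, u4, um2, um14, hu, tm14])
  obtain ⟨s₁, h₁⟩ : ∃ u, u = exec O X loadSample t := ⟨_, rfl⟩
  have hload' : ∀ r, s₁.mem 4 0 r = if r < t.idx 0 then s.mem 2 r j else t.mem 4 0 r := by
    intro r; rw [h₁]; exact hload r
  rw [← h₁]
  have e0 : s₁.idx 0 = k := by rw [h₁, exec_idx _ _ (by decide), t0]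
  have e2 : s₁.idx 2 = 0 := by rw [h₁, exec_idx _ _ (by decide), t2]
  have m3 : s₁.mem 3 = s.mem 3 := by rw [h₁, exec_mem _ _ (by decide), tm3]
  have m14 : s₁.mem 14 = t.mem 14 := by rw [h₁, exec_mem _ _ (by decide)]
  have hsol := exec_solve (O := O) (X := X) s₁ e2 (by rw [m14, tm14])
    (by rw [e0, m3]; exact hdet)
  obtain ⟨s₂, h₂⟩ : ∃ u, u = exec O X solve s₁ := ⟨_, rfl⟩
  rw [← h₂] at hsol ⊢
  rw [e0, m3] at hsol
  have hyj := hy j hj _ (hsol.trans (by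
    ext r
    rw [vecOf, hload', t0, if_pos r.2]
    rfl))
  have e0' : s₂.idx 0 = k := by rw [h₂, exec_idx _ _ (by decide), e0]
  have e2' : s₂.idx 2 = 0 := by rw [h₂, exec_idx _ _ (by decide), e2]
  have m1' : s₂.mem 1 = t.mem 1 := by
    rw [h₂, exec_mem _ _ (by decide), h₁, exec_mem _ _ (by decide)]
  have m15' : s₂.mem 15 = t.mem 15 := by
    rw [h₂, exec_mem _ _ (by decide), h₁, exec_mem _ _ (by decide)]
  have hacc := exec_vecLoop (O := O) (X := X) (x := 5) (b := 0) (s := s₂)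
    (p := .seq (.conj ⟨9, 2, 2⟩ ⟨5, 2, 5⟩) <|
    .seq (.mul ⟨9, 2, 2⟩ ⟨5, 2, 5⟩ ⟨9, 2, 2⟩) <| .add ⟨1, 2, 5⟩ ⟨1, 2, 5⟩ ⟨9, 2, 2⟩) 1 0
    (fun l => s₂.mem 1 0 l + s₂.mem 5 0 l * starRingEnd ℂ (s₂.mem 5 0 l))
    (fun i _ u hu1 hu hu3 hu4 r => by
      have u2 := (hu1 2 (by decide)).trans e2'
      have um5 := hu3 5 (by decide)
      simp [exec, Config.get, u2, um5, hu, hu4])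
  obtain ⟨s₃, h₃⟩ : ∃ u, u = exec O X accumulate s₂ := ⟨_, rfl⟩
  have hacc' : ∀ r : Fin k, s₃.mem 1 0 r =
      s₂.mem 1 0 r + s₂.mem 5 0 r * starRingEnd ℂ (s₂.mem 5 0 r) := by
    intro r; rw [h₃]; exact (hacc r).trans (if_pos (by rw [e0']; exact r.2))
  rw [← h₃]
  have e2'' : s₃.idx 2 = 0 := by rw [h₃, exec_idx _ _ (by decide), e2']
  have m15'' : s₃.mem 15 = t.mem 15 := by rw [h₃, exec_mem _ _ (by decide), m15']
  have m1'' : (exec O X countSample s₃).mem 1 = s₃.mem 1 := exec_mem _ _ (by decide)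
  refine ⟨?_, fun l => ?_⟩
  · simp [countSample, exec, Config.get, e2'', m15'', ht4.1]
  · rw [m1'', hacc', m1', ht4.2, Finset.sum_range_succ, ← hyj]
    rfl

lemma exec_average (s : Config) (h2 : s.idx 2 = 0) (l : ℕ) (hl : l < s.idx 0) :
    (exec O X average s).mem 1 0 l = s.mem 1 0 l / s.mem 15 0 0 := by
  refine (exec_vecLoop 1 0 (fun l => s.mem 1 0 l / s.mem 15 0 0) ?_ l).trans (if_pos hl)
  intro i _ t h1 ht h3 h4 r
  have t2 := (h1 2 (by decide)).trans h2
  have m15 := h3 15 (by decide)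
  simp [exec, Config.get, t2, m15, ht, h4]

end Correctness

/-! ### Correctness and cost of the whole program. -/

section Main

variable {O : Polynomial ℂ → List ℂ}

lemma entry_eq_firstEntries {d k n : ℕ} (h : 2 * k ≤ d) (x : Fin n → EuclideanSpace ℝ (Fin d))
    (j : Fin n) (i : Fin (2 * k)) : entry x i j = firstEntries h x j i := by
  rw [entry, dif_pos ⟨lt_of_lt_of_le i.2 h, j.2⟩]
  rfl

/-- Generic samples all share one Prony polynomial, so the nodes from sample `0`, and their single
Fourier matrix, serve to find the weights of every sample. -/
lemma holds_run_program {d k n : ℕ} (h : 2 * k ≤ d) (hn : 0 < n) {z : Fin k → ℂ}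
    (hz : Function.Injective z)
    (hOz : O (∏ l, (Polynomial.X - Polynomial.C (z l))) = List.ofFn z)
    {x : Fin n → EuclideanSpace ℝ (Fin d)} {y : Fin n → Fin k → ℂ}
    (hgen : ∀ j, IsGeneric z (firstEntries h x j) (y j)) :
    (run program O k x).Holds z fun l => (1 / (n : ℝ)) * ∑ j, ‖y j l‖ ^ 2 := by
  rw [run, program, exec]
  have hread := exec_readSamples_mem (O := O) (X := entry x) (init k n)
  obtain ⟨s, hs⟩ : ∃ t, t = exec O (entry x) readSamples (init k n) := ⟨_, rfl⟩
  rw [← hs] at hread ⊢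
  have e0 : s.idx 0 = k := by rw [hs, exec_idx _ _ (by decide)]; rfl
  have e1 : s.idx 1 = n := by rw [hs, exec_idx _ _ (by decide)]; rfl
  have e2 : s.idx 2 = 0 := by rw [hs, exec_idx _ _ (by decide)]; rfl
  have m1 : ∀ l, s.mem 1 0 l = 0 := fun l => by rw [hs, exec_mem _ _ (by decide)]; rfl
  have m14 : s.mem 14 0 0 = 0 := by rw [hs, exec_mem _ _ (by decide)]; rfl
  have m15 : s.mem 15 0 0 = 0 := by rw [hs, exec_mem _ _ (by decide)]; rfl
  have m2 : ∀ (j : Fin n) (i : Fin (2 * k)), s.mem 2 i j = firstEntries h x j i := by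
    intro j i
    rw [← entry_eq_firstEntries]
    rcases lt_or_ge (i : ℕ) k with hi | hi
    · exact (hread j j.2 i hi).1
    · have h1 := (hread j j.2 (i - k) (by have := i.2; change (i : ℕ) - k < k; omega)).2
      have h2 : (init k n).idx 0 + ((i : ℕ) - k) = i := by
        change k + ((i : ℕ) - k) = i; omega
      rwa [h2] at h1
  rw [compute, exec, exec]
  obtain ⟨c, hc, hR⟩ := exec_findNodes (O := O) (X := entry x) s e0 e2 m14
    (fun i => m2 ⟨0, hn⟩ i) ((hgen _).det_hankel_ne_zero hz)
  rw [((hgen _).coeffs_iff hz c).1 hc, hOz] at hR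
  obtain ⟨s₁, h₁⟩ : ∃ t, t = exec O (entry x) findNodes s := ⟨_, rfl⟩
  rw [← h₁] at hR ⊢
  have hR' : vecOf k (s₁.mem 0 0) = z := by
    ext l
    rw [vecOf, hR]
    simp
  have hV := exec_formVandermonde (O := O) (X := entry x) s₁
    (by rw [h₁, exec_idx _ _ (by decide), e2])
  obtain ⟨s₂, h₂⟩ : ∃ t, t = exec O (entry x) formVandermonde s₁ := ⟨_, rfl⟩
  rw [show s₁.idx 0 = k by rw [h₁, exec_idx _ _ (by decide), e0], hR', ← h₂] at hV
  have frame : ∀ A ∈ [1, 2, 14, 15], s₂.mem A = s.mem A := fun A hA => by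
    rw [h₂, exec_mem _ _ (by fin_cases hA <;> decide), h₁,
      exec_mem _ _ (by fin_cases hA <;> decide)]
  have frame' : ∀ r ∈ [0, 1, 2], s₂.idx r = s.idx r := fun r hr => by
    rw [h₂, exec_idx _ _ (by fin_cases hr <;> decide), h₁,
      exec_idx _ _ (by fin_cases hr <;> decide)]
  have hf0 : s₂.idx 0 = k := (frame' 0 (by decide)).trans e0
  have hf1 : s₂.idx 1 = n := (frame' 1 (by decide)).trans e1
  have hf2 : s₂.idx 2 = 0 := (frame' 2 (by decide)).trans e2
  have m0 : s₂.mem 0 = s₁.mem 0 := by rw [h₂, exec_mem _ _ (by decide)]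
  obtain ⟨h15, hD⟩ := exec_findWeights (O := O) (X := entry x) (k := k) s₂ hf0 hf2
    (by rw [frame 14 (by decide), m14]) (fun l => by rw [frame 1 (by decide), m1])
    (by rw [frame 15 (by decide), m15]) (by rw [hV]; exact det_fourierMatrix_ne_zero hz)
    (y := fun j => if hj : j < n then y ⟨j, hj⟩ else 0) (by
      intro j hj c hc
      rw [hf1] at hj
      rw [dif_pos hj]
      rw [hV] at hc
      refine ((hgen ⟨j, hj⟩).weights_iff hz c).1 (hc.trans ?_)
      ext i
      rw [vecOf, frame 2 (by decide)]
      exact m2 ⟨j, hj⟩ ⟨i, by omega⟩)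
  rw [exec, ← h₂]
  obtain ⟨s₃, h₃⟩ : ∃ t, t = exec O (entry x) findWeights s₂ := ⟨_, rfl⟩
  rw [← h₃] at h15 hD ⊢
  have m0' : s₃.mem 0 = s₁.mem 0 := by rw [h₃, exec_mem _ _ (by decide), m0]
  intro l
  constructor
  · rw [exec_mem _ _ (by decide), m0']
    exact congrFun hR' l
  · rw [exec_average s₃ (by rw [h₃, exec_idx _ _ (by decide), hf2]) l
      (by rw [h₃, exec_idx _ _ (by decide), hf0]; exact l.2), hD, h15, hf1, Finset.sum_range]
    push_cast
    rw [div_eq_inv_mul, one_div]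
    congr 1
    refine Finset.sum_congr rfl fun j _ => ?_
    rw [dif_pos j.2, Complex.mul_conj, Complex.normSq_eq_norm_sq]
    push_cast
    rfl

lemma run_program_reads {d k n : ℕ} (x : Fin n → EuclideanSpace ℝ (Fin d)) :
    (∀ i j : ℕ, (i, j) ∈ (run program O k x).reads ↔ i < 2 * k ∧ j < n) ∧
      (run program O k x).reads.length = 2 * k * n := by
  have h := exec_readSamples_reads (O := O) (X := entry x) (init k n) rfl
  have h1 : (run program O k x).reads = (exec O (entry x) readSamples (init k n)).reads := by
    rw [run, program, exec, exec_reads _ _ (by decide)]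
  rw [h1]
  exact ⟨h.2, h.1⟩

lemma run_program_queries {d k n : ℕ} (x : Fin n → EuclideanSpace ℝ (Fin d)) :
    (run program O k x).queries = 1 := by
  have h : ∀ s : Config, (exec O (entry x) findNodes s).queries = s.queries + 1 := by
    intro s
    have h1 : exec O (entry x) findNodes s = exec O (entry x) (.query 5 0 0)
      (exec O (entry x) (.seq formHankel <| .seq solve <| .const ⟨5, 2, 0⟩ 1) s) := rfl
    have h2 : ∀ t : Config, (exec O (entry x) (.query 5 0 0) t).queries = t.queries + 1 :=
      fun _ => rfl
    rw [h1, h2, exec_queries _ _ (by decide)]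
  rw [run, program, exec, compute, exec, exec_queries _ _ (by decide), h,
    exec_queries _ _ (by decide)]
  rfl

/-- Depth `4` comes from the loop over samples, the loop over equations and the two matrix loops in
one projection round. All are bounded by `k` or `n`. -/
lemma run_program_steps_le {d k n : ℕ} (hn : 0 < n) (x : Fin n → EuclideanSpace ℝ (Fin d)) :
    (run program O k x).steps ≤ 200 * (k + n) ^ 4 := by
  have h := exec_steps_le (O := O) (X := entry x) (N := k + n) (B := [0, 1]) program (init k n)
    (by simp [init]) (by decide) (by decide)
  have h1 := program.cost_le_size_mul_pow (N := k + n) (by omega)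
  have h2 : program.depth = 4 := by decide
  have h3 : program.size ≤ 200 := by decide
  have h4 : (init k n).steps = 0 := rfl
  rw [h2] at h1
  have h5 := Nat.mul_le_mul_right ((k + n) ^ 4) h3
  rw [run]
  omega

end Main

/-! ### Sample size and final constants. -/

section Arithmetic

variable {k n : ℕ} {ε δ : ℝ}

/-- The constant `32` is twice `16`: the exponential becomes at most `(δ / (2 k)) ^ 2`, and the
spare factor `δ / (2 k) < 1` makes the inequality strict. -/
lemma tail_bound_lt (hε : 0 < ε) (hδ : 0 < δ) (hδ1 : δ < 1) (hk : 1 ≤ k)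
    (hn : 32 * Real.log (2 * k / δ) / ε ^ 2 ≤ n) :
    2 * k * Real.exp (-(1 / 16) * n * ε ^ 2) < δ := by
  have hk' : (1 : ℝ) ≤ k := by exact_mod_cast hk
  have hq : 0 < 2 * k / δ := by positivity
  rw [div_le_iff₀ (by positivity)] at hn
  have h1 : Real.exp (-(1 / 16) * n * ε ^ 2) ≤ Real.exp (-Real.log (2 * k / δ)) ^ 2 := by
    rw [← Real.exp_nat_mul, Real.exp_le_exp]
    push_cast
    linarith
  rw [Real.exp_neg, Real.exp_log hq] at h1
  calc 2 * k * Real.exp (-(1 / 16) * n * ε ^ 2) ≤ 2 * k * ((2 * k / δ)⁻¹) ^ 2 := by gcongr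
    _ = δ * (δ / (2 * k)) := by field_simp
    _ < δ * 1 := by
        gcongr
        rw [div_lt_one (by positivity)]
        linarith
    _ = δ := mul_one δ

lemma log_two_mul_div (hδ : 0 < δ) (hk : 1 ≤ k) :
    Real.log (2 * k / δ) = Real.log 2 + Real.log (k / δ) := by
  have hk' : (1 : ℝ) ≤ k := by exact_mod_cast hk
  rw [mul_div_assoc, Real.log_mul (by norm_num) (by positivity)]

lemma half_le_log_two_mul_div (hδ : 0 < δ) (hδ1 : δ < 1) (hk : 1 ≤ k) :
    1 / 2 ≤ Real.log (2 * k / δ) := by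
  have hk' : (1 : ℝ) ≤ k := by exact_mod_cast hk
  have h1 := Real.log_two_gt_d9
  have h2 : 0 ≤ Real.log (k / δ) := Real.log_nonneg (by rw [le_div_iff₀ hδ]; linarith)
  rw [log_two_mul_div hδ hk]
  linarith

/-- The ceiling adds less than `1`, and `1` is at most twice the quotient because the logarithm is
at least `1 / 2`; hence `34 = 32 + 2`. -/
lemma sample_size_le (hε : 0 < ε) (hε1 : ε < 1) (hδ : 0 < δ) (hδ1 : δ < 1) (hk : 1 ≤ k)
    (hn : n = ⌈32 * Real.log (2 * k / δ) / ε ^ 2⌉₊) :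
    (n : ℝ) ≤ 34 * (Real.log (2 * k / δ) / ε ^ 2) := by
  have hL := half_le_log_two_mul_div hδ hδ1 hk
  set L := Real.log (2 * k / δ)
  have h1 : (n : ℝ) < 32 * L / ε ^ 2 + 1 := by
    rw [hn]; exact Nat.ceil_lt_add_one (by positivity)
  have h2 : 1 / 2 ≤ L / ε ^ 2 := by
    rw [le_div_iff₀ (by positivity)]
    have : ε ^ 2 ≤ 1 := pow_le_one₀ hε.le hε1.le
    linarith
  rw [mul_div_assoc] at h1
  linarith

lemma add_sample_size_le (hε : 0 < ε) (hε1 : ε < 1) (hδ : 0 < δ) (hδ1 : δ < 1) (hk : 1 ≤ k)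
    (hn : n = ⌈32 * Real.log (2 * k / δ) / ε ^ 2⌉₊) :
    ((k : ℝ) + n) ≤ (k + 1 / ε + Real.log (1 / δ)) ^ 10 := by
  have hk' : (1 : ℝ) ≤ k := by exact_mod_cast hk
  have h1 := sample_size_le hε hε1 hδ hδ1 hk hn
  have hδ' : 0 ≤ Real.log (1 / δ) := Real.log_nonneg (by rw [le_div_iff₀ hδ]; linarith)
  have hε' : 1 ≤ 1 / ε := by rw [le_div_iff₀ hε]; linarith
  set S := k + 1 / ε + Real.log (1 / δ) with hS
  -- Since `S ≥ 2`, numerical factors can be traded for powers of `S`: the bound `2 ^ 7 * S ^ 3`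
  -- below becomes `S ^ 10`.
  have hS2 : 2 ≤ S := by linarith
  have hlog : Real.log (2 * k / δ) ≤ 2 * S := by
    have e : (2 : ℝ) * k / δ = (2 * k) * (1 / δ) := by ring
    rw [e, Real.log_mul (by positivity) (by positivity)]
    have := Real.log_le_self (by positivity : (0 : ℝ) ≤ 2 * k)
    linarith
  have hinv : 1 / ε ^ 2 ≤ S ^ 2 := by
    rw [← _root_.one_div_pow]
    gcongr
    linarith
  have h2 : Real.log (2 * k / δ) / ε ^ 2 ≤ 2 * S * S ^ 2 := by
    rw [div_eq_mul_one_div]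
    gcongr
  have h3 : S ≤ S ^ 3 := le_self_pow₀ (by linarith) (by norm_num)
  have h4 : (2 : ℝ) ^ 7 ≤ S ^ 7 := by gcongr
  calc (k : ℝ) + n ≤ S + 34 * (2 * S * S ^ 2) := by linarith
    _ ≤ 2 ^ 7 * S ^ 3 := by nlinarith
    _ ≤ S ^ 7 * S ^ 3 := by gcongr
    _ = S ^ 10 := by ring

lemma mul_pow_four_le {x S : ℝ} (hS : 1 ≤ S) (hx : 0 ≤ x) (h : x ≤ S ^ 10) :
    200 * x ^ 4 ≤ ((200 : ℕ) : ℝ) * S ^ 200 := by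
  have h1 : x ^ 4 ≤ S ^ 40 := by
    calc x ^ 4 ≤ (S ^ 10) ^ 4 := by gcongr
      _ = S ^ 40 := by rw [← pow_mul]
  have h2 : S ^ 40 ≤ S ^ 200 := pow_le_pow_right₀ hS (by norm_num)
  push_cast
  linarith

end Arithmetic

end Prony

theorem mainTheorem5 :
    ∃ (C A B : ℝ) (a : ℕ) (P : Prony.Cmd), 0 < C ∧ 0 < A ∧ 0 < B ∧
      ∀ (d k n : ℕ) (h : 2 * k ≤ d) (T : Matrix (Fin d) (Fin d) ℝ) (O : Polynomial ℂ → List ℂ),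
        T.PosSemidef → Prony.IsToeplitz T → T.rank = k → Prony.IsRootOracle k O → 0 < n →
        -- almost surely the algorithm has exactly one output, `R` is a set of `k` frequencies,
        -- and the program `P` computes this output
        (∀ᵐ x ∂(Prony.samplesLaw T n), ∃ (R : Fin k → ℂ) (D : Fin k → ℝ),
          Prony.IsOutput O (Prony.firstEntries h x) R D ∧
          (∀ (R' : Fin k → ℂ) (D' : Fin k → ℝ),
            Prony.IsOutput O (Prony.firstEntries h x) R' D' → R' = R ∧ D' = D) ∧
          (∃ f : Fin k → ℝ, Function.Injective f ∧ (∀ l, f l ∈ Set.Ico (0 : ℝ) 1) ∧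
            ∀ l, R l = Complex.exp (-2 * Real.pi * Complex.I * f l)) ∧
          (Prony.run P O k x).Holds R D) ∧
        -- the tail bound
        (∀ ε : ℝ, 0 < ε → ε < 1 →
          Prony.samplesLaw T n (Prony.failure h T O n ε) ≤
            ENNReal.ofReal (2 * k * Real.exp (-C * n * ε ^ 2))) ∧
        -- the resources used by `P`, on all samples
        (∀ x : Fin n → EuclideanSpace ℝ (Fin d),
          (∀ i j : ℕ, (i, j) ∈ (Prony.run P O k x).reads ↔ i < 2 * k ∧ j < n) ∧
          (Prony.run P O k x).reads.length = 2 * k * n ∧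
          (Prony.run P O k x).queries ≤ n ∧
          (Prony.run P O k x).steps ≤ a * (k + n) ^ a) ∧
        -- failure probability `δ`
        (∀ ε δ : ℝ, 0 < ε → ε < 1 → 0 < δ → δ < 1 → 1 ≤ k →
          (A * Real.log (2 * k / δ) / ε ^ 2 ≤ n →
            Prony.samplesLaw T n (Prony.failure h T O n ε) < ENNReal.ofReal δ) ∧
          (n = ⌈A * Real.log (2 * k / δ) / ε ^ 2⌉₊ →
            ∀ x : Fin n → EuclideanSpace ℝ (Fin d),
              ((Prony.run P O k x).reads.length : ℝ) ≤ B * (k * Real.log (2 * k / δ) / ε ^ 2) ∧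
              (2 * δ ≤ k →
                ((Prony.run P O k x).reads.length : ℝ) ≤ B * (k * Real.log (k / δ) / ε ^ 2)) ∧
              ((Prony.run P O k x).steps : ℝ) ≤ a * (k + 1 / ε + Real.log (1 / δ)) ^ a)) := by
  -- `136 = 2 * 68` with `68 = 2 * 34`, where the outer doubling pays for replacing `log (2 k / δ)`
  -- by `log (k / δ)`. The number `200` bounds the program size and generously also the exponents
  -- `4` and `40`.
  refine ⟨1 / 16, 32, 136, 200, Prony.program, by norm_num, by norm_num, by norm_num, ?_⟩
  intro d k n h T O hT hTo hrank hO hn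
  have htail : ∀ ε : ℝ, 0 < ε → ε < 1 →
      Prony.samplesLaw T n (Prony.failure h T O n ε) ≤
        ENNReal.ofReal (2 * k * Real.exp (-(1 / 16) * n * ε ^ 2)) := fun ε hε hε1 =>
    Prony.samplesLaw_failure_le h hT hTo hrank hO hn hε hε1
  refine ⟨?_, htail, fun x => ?_, fun ε δ hε hε1 hδ hδ1 hk => ⟨fun hn' => ?_, fun hn' x => ?_⟩⟩
  · obtain ⟨z, D, G, hz, hz1, hOz, _, _, _, hgen⟩ := Prony.exists_model h hT hTo hrank hO
    filter_upwards [hgen n] with x hx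
    refine ⟨z, fun l => (1 / (n : ℝ)) * ∑ j, ‖Prony.functional (G l) (x j)‖ ^ 2,
      (Prony.isOutput_iff_of_isGeneric hn hz hOz hx _ _).2 ⟨rfl, rfl⟩,
      fun R' D' => (Prony.isOutput_iff_of_isGeneric hn hz hOz hx R' D').1, ?_,
      Prony.holds_run_program h hn hz hOz hx⟩
    choose f hf hzf using fun l => Prony.exists_frequency (hz1 l)
    refine ⟨f, fun l m hlm => hz ?_, hf, hzf⟩
    rw [hzf l, hzf m, hlm]
  · obtain ⟨h1, h2⟩ := Prony.run_program_reads (O := O) (k := k) x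
    refine ⟨h1, h2, by rw [Prony.run_program_queries]; exact hn, ?_⟩
    refine (Prony.run_program_steps_le hn x).trans (Nat.mul_le_mul_left _ ?_)
    exact Nat.pow_le_pow_right (by omega) (by norm_num)
  · refine (htail ε hε hε1).trans_lt ?_
    rw [ENNReal.ofReal_lt_ofReal_iff hδ]
    exact Prony.tail_bound_lt hε hδ hδ1 hk hn'
  · have hk' : (1 : ℝ) ≤ k := by exact_mod_cast hk
    have hsize := Prony.sample_size_le hε hε1 hδ hδ1 hk hn'
    have hL := Prony.half_le_log_two_mul_div hδ hδ1 hk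
    have hread : ((Prony.run Prony.program O k x).reads.length : ℝ) ≤
        68 * (k * Real.log (2 * k / δ) / ε ^ 2) := by
      rw [(Prony.run_program_reads x).2]
      push_cast
      calc 2 * (k : ℝ) * n ≤ 2 * k * (34 * (Real.log (2 * k / δ) / ε ^ 2)) := by gcongr
        _ = 68 * (k * Real.log (2 * k / δ) / ε ^ 2) := by ring
    refine ⟨hread.trans ?_, fun h2δ => hread.trans ?_, ?_⟩
    · have : 0 ≤ k * Real.log (2 * k / δ) / ε ^ 2 := by positivity
      linarith
    -- The condition `2 δ ≤ k` says exactly that the extra `log 2` is absorbed by a second copy of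
    -- `log (k / δ)`.
    · have h1 : Real.log 2 ≤ Real.log (k / δ) :=
        Real.log_le_log (by norm_num) (by rw [le_div_iff₀ hδ]; exact h2δ)
      have h2 : Real.log (2 * k / δ) ≤ 2 * Real.log (k / δ) := by
        rw [Prony.log_two_mul_div hδ hk]; linarith
      calc 68 * (k * Real.log (2 * k / δ) / ε ^ 2)
          ≤ 68 * (k * (2 * Real.log (k / δ)) / ε ^ 2) := by gcongr
        _ = 136 * (k * Real.log (k / δ) / ε ^ 2) := by ring
    · have hδ' : 0 ≤ Real.log (1 / δ) := Real.log_nonneg (by rw [le_div_iff₀ hδ]; linarith)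
      have hε' : 0 < 1 / ε := by positivity
      have h1 : ((Prony.run Prony.program O k x).steps : ℝ) ≤ 200 * ((k : ℝ) + n) ^ 4 := by
        exact_mod_cast Prony.run_program_steps_le (O := O) hn x
      refine h1.trans ?_
      exact Prony.mul_pow_four_le (by linarith) (by positivity)
        (Prony.add_sample_size_le hε hε1 hδ hδ1 hk hn')
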